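/- Let $H$ and $U$ be complex Hilbert spaces. Let $A_1 : D(A_1)\subset H\to H$ be the generator of a $C_0$-semigroup $(S_1(t))_{t\ge 0}$ on $H$. Equip $D(A_1^*)$ with the graph norm, let $D(A_1^*)'$ be its dual with respect to the pivot space $H$ (the bounded conjugate-linear functionals on $D(A_1^*)$, where $x\in H$ is identified with $z\mapsto\langle x,z\rangle_H$), and let $B\in\mathcal L(U,D(A_1^*)')$, with adjoint $B^*\in\mathcal L(D(A_1^*),U)$. Assume that $B$ is admissible for $A_1$: for some $T>0$ and every $u\in L^2(0,+\infty;U)$, the element $\int_0^T S_1(T-s)Bu(s)\,ds$ of $D(A_1^*)'$ belongs to $H$. Here $S_1(t)$ is extended to $D(A_1^*)'$ by $\langle S_1(t)f,z\rangle=\langle f,S_1(t)^*z\rangle$, and the integral is defined by $\left\langle\int_0^T S_1(T-s)Bu(s)\,ds,z\right\rangle=\int_0^T\langle S_1(T-s)Bu(s),z\rangle\,ds$ for $z\in D(A_1^*)$. Let $P\in\mathcal L(H)$ and $A_2=A_1+P$ with $D(A_2)=D(A_1)$. (Recall that $D(A_2^*)=D(A_1^*)$ with equivalent graph norms, so that $B$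 may be regarded as an element of $\mathcal L(U,D(A_2^*)')$.) For $z^0\in H$ put $\tilde z(t)=S_1(t)^*z^0$ and $$V\tilde z(t)=\int_0^t S_1(t-s)^*P^*\tilde z(s)\,ds .$$ Assume that there are $\varepsilon>0$, a complex Hilbert space $\widehat H$, a function $G\in L^2(0,\varepsilon;\mathcal L(H,\widehat H))$ with $G(t)$ compact for a.e. $t\in(0,\varepsilon)$, and $C>0$ such that, for a.e. $t\in(0,\varepsilon)$, $$\|B^*V\tilde z(t)\|_U+\|V\tilde z(t)\|_H\le C\,\|G(t)z^0\|_{\widehat H}\qquad\text{for all } z^0\in D(A_1^*)$$ (for such $z^0$ one has $V\tilde z(t)\in D(A_1^*)$, so that $B^*V\tilde z(t)$ makes sense). Then $A_2$ generates a $C_0$-semigroup $(S_2(t))_{t\ge0}$ on $H$, and $B$ is admissible for $A_2$. For $i=1,2$ and every $T>0$ the input map $\Phi_i(T)\in\mathcal L(L^2(0,+\infty;U),H)$, $\Phi_i(T)u=\int_0^T S_i(T-s)Bu(s)\,ds$, is well defined, and the operator $$\Phi_1(T)^*-\Phi_2(T)^*:\ H\to L^2(0,+\infty;U)$$ is compact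 for every $T>0$. -/

import Mathlib

open MeasureTheory Filter Topology Set
open scoped NNReal InnerProductSpace

noncomputable section

section Semigroups

variable {H : Type*} [NormedAddCommGroup H] [InnerProductSpace ℂ H]

/-- A `C₀`-semigroup (strongly continuous one-parameter semigroup of bounded operators) on `H`. -/
structure C0Semigroup (H : Type*) [NormedAddCommGroup H] [InnerProductSpace ℂ H] where
  /-- The operator `S(t)`, for `t ≥ 0`. -/
  toFun : ℝ≥0 → (H →L[ℂ] H)
  map_zero' : toFun 0 = ContinuousLinearMap.id ℂ H
  map_add' : ∀ s t : ℝ≥0, toFun (s + t) = (toFun s).comp (toFun t)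
  tendsto_zero' : ∀ x : H, Tendsto (fun t : ℝ≥0 => toFun t x) (𝓝 0) (𝓝 x)

/-- `S.opAt t` is the operator `S(t)` for a real time `t ≥ 0` (only such times matter). -/
def C0Semigroup.opAt (S : C0Semigroup H) (t : ℝ) : H →L[ℂ] H := S.toFun t.toNNReal

/-- The infinitesimal generator: `A x = lim_{h → 0+} (S(h) x - x) / h`, with domain the set of
those `x` for which this limit exists. `S.IsGeneratedBy A` says that `A` is the generator of `S`,
domain included. -/
def C0Semigroup.IsGeneratedBy (S : C0Semigroup H) (A : H →ₗ.[ℂ] H) : Prop :=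
  ∀ x y : H, (x, y) ∈ A.graph ↔
    Tendsto (fun h : ℝ => h⁻¹ • (S.opAt h x - x)) (𝓝[>] 0) (𝓝 y)

/-- The operator `A + P` with domain `D(A + P) = D(A)`, for a bounded operator `P`. -/
def LinearPMap.boundedPerturbation (A : H →ₗ.[ℂ] H) (P : H →L[ℂ] H) : H →ₗ.[ℂ] H where
  domain := A.domain
  toFun := A.toFun + P.toLinearMap.comp A.domain.subtype

end Semigroups

section AdjointDomain

variable {H : Type*} [NormedAddCommGroup H] [InnerProductSpace ℂ H] [CompleteSpace H]

/-- The domain `D(A*)` of the adjoint of `A`; below it is given the graph norm. -/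
def AdjointDomain (A : H →ₗ.[ℂ] H) : Type _ := A.adjoint.domain

instance (A : H →ₗ.[ℂ] H) : AddCommGroup (AdjointDomain A) :=
  inferInstanceAs (AddCommGroup A.adjoint.domain)

instance (A : H →ₗ.[ℂ] H) : Module ℂ (AdjointDomain A) :=
  inferInstanceAs (Module ℂ A.adjoint.domain)

/-- The inclusion `D(A*) → H`. -/
def AdjointDomain.incl (A : H →ₗ.[ℂ] H) : AdjointDomain A →ₗ[ℂ] H := A.adjoint.domain.subtype

/-- The map `z ↦ A* z` on `D(A*)`. -/
def AdjointDomain.op (A : H →ₗ.[ℂ] H) : AdjointDomain A →ₗ[ℂ] H := A.adjoint.toFun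

/-- The map `z ↦ (z, A* z)`, from `D(A*)` to the Hilbert direct sum `H ⊕ H`. -/
def AdjointDomain.toGraph (A : H →ₗ.[ℂ] H) : AdjointDomain A →ₗ[ℂ] WithLp 2 (H × H) :=
  (WithLp.linearEquiv 2 ℂ (H × H)).symm.toLinearMap.comp
    ((AdjointDomain.incl A).prod (AdjointDomain.op A))

theorem AdjointDomain.incl_injective (A : H →ₗ.[ℂ] H) :
    Function.Injective (AdjointDomain.incl A) := Subtype.val_injective

theorem AdjointDomain.toGraph_injective (A : H →ₗ.[ℂ] H) :
    Function.Injective (AdjointDomain.toGraph A) := by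
  intro x y h
  have h' : (AdjointDomain.incl A x, AdjointDomain.op A x)
      = (AdjointDomain.incl A y, AdjointDomain.op A y) :=
    (WithLp.linearEquiv 2 ℂ (H × H)).symm.injective h
  exact AdjointDomain.incl_injective A (congrArg Prod.fst h')

/-- The graph norm `‖z‖ = (‖z‖² + ‖A* z‖²)^(1/2)` on `D(A*)`. -/
instance (A : H →ₗ.[ℂ] H) : NormedAddCommGroup (AdjointDomain A) :=
  NormedAddCommGroup.induced _ _ (AdjointDomain.toGraph A) (AdjointDomain.toGraph_injective A)

instance (A : H →ₗ.[ℂ] H) : NormedSpace ℂ (AdjointDomain A) :=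
  NormedSpace.induced ℂ _ _ (AdjointDomain.toGraph A)

theorem AdjointDomain.norm_eq (A : H →ₗ.[ℂ] H) (z : AdjointDomain A) :
    ‖z‖ = Real.sqrt (‖AdjointDomain.incl A z‖ ^ 2 + ‖AdjointDomain.op A z‖ ^ 2) :=
  WithLp.prod_norm_eq_of_L2 (AdjointDomain.toGraph A z)

theorem AdjointDomain.continuous_iff (A : H →ₗ.[ℂ] H) {X : Type*} [TopologicalSpace X]
    (f : X → AdjointDomain A) :
    Continuous f ↔ Continuous (fun x => AdjointDomain.incl A (f x)) ∧
      Continuous (fun x => AdjointDomain.op A (f x)) := by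
  have hind : IsInducing (AdjointDomain.toGraph A) := ⟨rfl⟩
  rw [hind.continuous_iff]
  constructor
  · intro h
    have h2 : Continuous (fun x => WithLp.ofLp (AdjointDomain.toGraph A (f x))) :=
      (WithLp.prod_continuous_ofLp 2 H H).comp h
    exact ⟨continuous_fst.comp h2, continuous_snd.comp h2⟩
  · rintro ⟨h1, h2⟩
    exact (WithLp.prod_continuous_toLp 2 H H).comp (h1.prodMk h2)

theorem AdjointDomain.continuous_incl (A : H →ₗ.[ℂ] H) : Continuous (AdjointDomain.incl A) :=
  ((AdjointDomain.continuous_iff A id).1 continuous_id).1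

theorem AdjointDomain.continuous_op (A : H →ₗ.[ℂ] H) : Continuous (AdjointDomain.op A) :=
  ((AdjointDomain.continuous_iff A id).1 continuous_id).2

/-- The space `D(A*)'`: bounded conjugate-linear functionals on `D(A*)` with the graph norm.
With conjugate-linear functionals `H` embeds linearly in `D(A*)'` through `x ↦ (z ↦ ⟪z, x⟫)`
(`H` is the pivot space). -/
abbrev AdjointDomainDual (A : H →ₗ.[ℂ] H) : Type _ := AdjointDomain A →L⋆[ℂ] ℂ

theorem C0Semigroup.adjoint_mem (S : C0Semigroup H) {A : H →ₗ.[ℂ] H} (hA : S.IsGeneratedBy A)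
    (t : ℝ) (z : AdjointDomain A) :
    ∃ w : AdjointDomain A,
      AdjointDomain.incl A w = ContinuousLinearMap.adjoint (S.opAt t) (AdjointDomain.incl A z) ∧
      AdjointDomain.op A w = ContinuousLinearMap.adjoint (S.opAt t) (AdjointDomain.op A z) := by
  have hcomm : ∀ x : A.domain, ∃ x' : A.domain, (x' : H) = S.opAt t x ∧ A x' = S.opAt t (A x) := by
    intro x
    have h1 := (hA (x : H) (A x)).1 (A.mem_graph x)
    have h2 : Tendsto (fun h : ℝ => h⁻¹ • (S.opAt h (S.opAt t x) - S.opAt t x)) (𝓝[>] 0)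
        (𝓝 (S.opAt t (A x))) := by
      refine (((S.opAt t).continuous.tendsto _).comp h1).congr fun h => ?_
      have hc : S.opAt t (S.opAt h x) = S.opAt h (S.opAt t x) := by
        have e1 := S.map_add' t.toNNReal h.toNNReal
        have e2 := S.map_add' h.toNNReal t.toNNReal
        rw [add_comm, e2] at e1
        exact (DFunLike.congr_fun e1 (x : H)).symm
      simp only [Function.comp_apply]
      rw [← hc, ← map_sub]
      exact ContinuousLinearMap.map_smul_of_tower (S.opAt t) (h⁻¹ : ℝ) _
    have h3 := (hA _ _).2 h2
    rw [LinearPMap.mem_graph_iff] at h3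
    exact h3
  by_cases hd : Dense (A.domain : Set H)
  · have key : ∀ x : A.domain,
        ⟪ContinuousLinearMap.adjoint (S.opAt t) (AdjointDomain.op A z), (x : H)⟫_ℂ
          = ⟪ContinuousLinearMap.adjoint (S.opAt t) (AdjointDomain.incl A z), A x⟫_ℂ := by
      intro x
      obtain ⟨x', hx1, hx2⟩ := hcomm x
      rw [ContinuousLinearMap.adjoint_inner_left, ContinuousLinearMap.adjoint_inner_left,
        ← hx1, ← hx2]
      exact LinearPMap.adjoint_isFormalAdjoint hd z x'
    exact ⟨⟨_, LinearPMap.mem_adjoint_domain_of_exists _ ⟨_, key⟩⟩, rfl,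
      LinearPMap.adjoint_apply_eq hd _ key⟩
  · refine ⟨⟨ContinuousLinearMap.adjoint (S.opAt t) (AdjointDomain.incl A z), ?_⟩, rfl, ?_⟩
    · rw [LinearPMap.mem_adjoint_domain_iff]
      have hz : Continuous ((innerₛₗ ℂ (AdjointDomain.incl A z)).comp A.toFun) := z.2
      choose g hg1 hg2 using hcomm
      have hg : Continuous g := by
        refine continuous_induced_rng.2 ?_
        exact ((S.opAt t).continuous.comp continuous_subtype_val).congr fun x => (hg1 x).symm
      refine (hz.comp hg).congr fun x => ?_
      change ⟪AdjointDomain.incl A z, A (g x)⟫_ℂ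
        = ⟪ContinuousLinearMap.adjoint (S.opAt t) (AdjointDomain.incl A z), A x⟫_ℂ
      rw [hg2, ContinuousLinearMap.adjoint_inner_left]
    · have h0 : ∀ w : AdjointDomain A, AdjointDomain.op A w = 0 := fun w =>
        LinearPMap.adjoint_apply_of_not_dense hd w
      exact (h0 _).trans (by rw [h0 z, map_zero])

/-- The restriction of `S(t)*` to `D(A*)`, a bounded operator for the graph norm. -/
def C0Semigroup.adjointRestrict (S : C0Semigroup H) {A : H →ₗ.[ℂ] H} (hA : S.IsGeneratedBy A)
    (t : ℝ) : AdjointDomain A →L[ℂ] AdjointDomain A where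
  toFun z := (S.adjoint_mem hA t z).choose
  map_add' x y := by
    apply AdjointDomain.incl_injective A
    have hs := fun z => (S.adjoint_mem hA t z).choose_spec.1
    refine (hs _).trans ?_
    rw [map_add, map_add, map_add, hs, hs]
  map_smul' c x := by
    apply AdjointDomain.incl_injective A
    have hs := fun z => (S.adjoint_mem hA t z).choose_spec.1
    refine (hs _).trans ?_
    rw [map_smul, map_smul, map_smul, hs, RingHom.id_apply]
  cont := by
    rw [AdjointDomain.continuous_iff]
    constructor
    · exact ((ContinuousLinearMap.adjoint (S.opAt t)).continuous.comp
        (AdjointDomain.continuous_incl A)).congr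
          fun z => ((S.adjoint_mem hA t z).choose_spec.1).symm
    · exact ((ContinuousLinearMap.adjoint (S.opAt t)).continuous.comp
        (AdjointDomain.continuous_op A)).congr
          fun z => ((S.adjoint_mem hA t z).choose_spec.2).symm

theorem C0Semigroup.incl_adjointRestrict (S : C0Semigroup H) {A : H →ₗ.[ℂ] H}
    (hA : S.IsGeneratedBy A) (t : ℝ) (z : AdjointDomain A) :
    AdjointDomain.incl A (S.adjointRestrict hA t z)
      = ContinuousLinearMap.adjoint (S.opAt t) (AdjointDomain.incl A z) :=
  (S.adjoint_mem hA t z).choose_spec.1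

/-- The extension of `S(t)` to `D(A*)'`: `⟨S(t) f, z⟩ = ⟨f, S(t)* z⟩` for `z ∈ D(A*)`. -/
def C0Semigroup.extension (S : C0Semigroup H) {A : H →ₗ.[ℂ] H} (hA : S.IsGeneratedBy A)
    (t : ℝ) (f : AdjointDomainDual A) : AdjointDomainDual A :=
  f.comp (S.adjointRestrict hA t)

theorem AdjointDomain.exists_of_perturbed (A : H →ₗ.[ℂ] H) (P : H →L[ℂ] H)
    (z : AdjointDomain (A.boundedPerturbation P)) :
    ∃ w : AdjointDomain A,
      AdjointDomain.incl A w = AdjointDomain.incl (A.boundedPerturbation P) z := by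
  refine ⟨⟨AdjointDomain.incl (A.boundedPerturbation P) z, ?_⟩, rfl⟩
  rw [LinearPMap.mem_adjoint_domain_iff]
  set y : H := AdjointDomain.incl (A.boundedPerturbation P) z
  have hz : Continuous ((innerₛₗ ℂ y).comp (A.boundedPerturbation P).toFun) := z.2
  have hP : Continuous (fun x : A.domain => ⟪y, P (x : H)⟫_ℂ) := by fun_prop
  refine (hz.sub hP).congr fun x => ?_
  change ⟪y, A x + P x⟫_ℂ - ⟪y, P x⟫_ℂ = ⟪y, A x⟫_ℂ
  rw [inner_add_right, add_sub_cancel_right]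

/-- The identification of `D((A + P)*)` with `D(A*)` (the same vectors, equivalent norms), as a
bounded operator. -/
def AdjointDomain.ofPerturbed (A : H →ₗ.[ℂ] H) (P : H →L[ℂ] H) :
    AdjointDomain (A.boundedPerturbation P) →L[ℂ] AdjointDomain A where
  toFun z := (AdjointDomain.exists_of_perturbed A P z).choose
  map_add' x y := by
    apply AdjointDomain.incl_injective A
    have hs := fun z => (AdjointDomain.exists_of_perturbed A P z).choose_spec
    refine (hs _).trans ?_
    rw [map_add, map_add, hs, hs]
  map_smul' c x := by
    apply AdjointDomain.incl_injective A
    have hs := fun z => (AdjointDomain.exists_of_perturbed A P z).choose_spec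
    refine (hs _).trans ?_
    rw [map_smul, map_smul, hs, RingHom.id_apply]
  cont := by
    have hincl := AdjointDomain.continuous_incl (A.boundedPerturbation P)
    have hop := AdjointDomain.continuous_op (A.boundedPerturbation P)
    have hspec := fun z => (AdjointDomain.exists_of_perturbed A P z).choose_spec
    rw [AdjointDomain.continuous_iff]
    refine ⟨hincl.congr fun z => (hspec z).symm, ?_⟩
    by_cases hd : Dense (A.domain : Set H)
    · refine (hop.sub ((ContinuousLinearMap.adjoint P).continuous.comp hincl)).congr fun z => ?_
      symm
      refine LinearPMap.adjoint_apply_eq hd _ fun x => ?_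
      have h1 : ⟪AdjointDomain.op (A.boundedPerturbation P) z, (x : H)⟫_ℂ
          = ⟪AdjointDomain.incl (A.boundedPerturbation P) z, A x + P x⟫_ℂ :=
        LinearPMap.adjoint_isFormalAdjoint (T := A.boundedPerturbation P) hd z x
      have h2 : ⟪AdjointDomain.incl A (AdjointDomain.exists_of_perturbed A P z).choose, A x⟫_ℂ
          = ⟪AdjointDomain.incl (A.boundedPerturbation P) z, A x⟫_ℂ := by rw [hspec z]
      refine Eq.trans ?_ h2.symm
      change ⟪AdjointDomain.op (A.boundedPerturbation P) z - ContinuousLinearMap.adjoint P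
        (AdjointDomain.incl (A.boundedPerturbation P) z), (x : H)⟫_ℂ = _
      rw [inner_sub_left, ContinuousLinearMap.adjoint_inner_left, h1, inner_add_right,
        add_sub_cancel_right]
    · exact continuous_const.congr fun z =>
        (LinearPMap.adjoint_apply_of_not_dense hd
          (AdjointDomain.exists_of_perturbed A P z).choose).symm

theorem AdjointDomain.incl_ofPerturbed (A : H →ₗ.[ℂ] H) (P : H →L[ℂ] H)
    (z : AdjointDomain (A.boundedPerturbation P)) :
    AdjointDomain.incl A (AdjointDomain.ofPerturbed A P z)
      = AdjointDomain.incl (A.boundedPerturbation P) z :=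
  (AdjointDomain.exists_of_perturbed A P z).choose_spec

end AdjointDomain

section Control

variable {H : Type*} [NormedAddCommGroup H] [InnerProductSpace ℂ H] [CompleteSpace H]
variable {U : Type*} [NormedAddCommGroup U] [InnerProductSpace ℂ U]

/-- The operator `B`, seen as an element of `L(U, D((A + P)*)')` through the identification of
`D((A + P)*)` with `D(A*)`. -/
def perturbedControl {A : H →ₗ.[ℂ] H} (B : U →L[ℂ] AdjointDomainDual A) (P : H →L[ℂ] H) :
    U →L[ℂ] AdjointDomainDual (A.boundedPerturbation P) :=
  LinearMap.mkContinuous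
    { toFun := fun v => (B v).comp (AdjointDomain.ofPerturbed A P)
      map_add' := fun v w => by ext z; simp
      map_smul' := fun c v => by ext z; simp }
    (‖B‖ * ‖AdjointDomain.ofPerturbed A P‖) (fun v => by
      refine ((B v).opNorm_comp_le _).trans ?_
      calc ‖B v‖ * ‖AdjointDomain.ofPerturbed A P‖
          ≤ (‖B‖ * ‖v‖) * ‖AdjointDomain.ofPerturbed A P‖ := by
            gcongr
            exact B.le_opNorm v
        _ = ‖B‖ * ‖AdjointDomain.ofPerturbed A P‖ * ‖v‖ := by ring)

/-- The adjoint `B* : D(A*) → U`: the vector with `⟪B* z, v⟫_U = ⟨B v, z⟩` for every `v ∈ U`. -/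
def controlAdjoint [CompleteSpace U] {A : H →ₗ.[ℂ] H} (B : U →L[ℂ] AdjointDomainDual A)
    (z : AdjointDomain A) : U :=
  (InnerProductSpace.toDual ℂ U).symm
    (LinearMap.mkContinuous
      { toFun := fun v => B v z
        map_add' := fun v w => by simp
        map_smul' := fun c v => by simp }
      (‖B‖ * ‖z‖) (fun v => by
        refine ((B v).le_opNorm z).trans ?_
        calc ‖B v‖ * ‖z‖ ≤ (‖B‖ * ‖v‖) * ‖z‖ := by
              gcongr
              exact B.le_opNorm v
          _ = ‖B‖ * ‖z‖ * ‖v‖ := by ring))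

theorem inner_controlAdjoint [CompleteSpace U] {A : H →ₗ.[ℂ] H} (B : U →L[ℂ] AdjointDomainDual A)
    (z : AdjointDomain A) (v : U) : ⟪controlAdjoint B z, v⟫_ℂ = B v z :=
  InnerProductSpace.toDual_symm_apply

/-- The control space `L²(0, +∞; U)`. -/
abbrev ControlSpace (U : Type*) [NormedAddCommGroup U] [InnerProductSpace ℂ U] : Type _ :=
  Lp U 2 (volume.restrict (Ioi (0 : ℝ)))

/-- The value at `z ∈ D(A*)` of `∫₀ᵀ S(T - s) B u(s) ds ∈ D(A*)'`. -/
def inputFunctional (S : C0Semigroup H) {A : H →ₗ.[ℂ] H} (hA : S.IsGeneratedBy A)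
    (B : U →L[ℂ] AdjointDomainDual A) (T : ℝ) (u : ControlSpace U) (z : AdjointDomain A) : ℂ :=
  ∫ s in (0 : ℝ)..T, S.extension hA (T - s) (B (u s)) z

/-- `B` is admissible for `A`: for some time `T > 0` and for every `u ∈ L²(0, +∞; U)`, the element
`∫₀ᵀ S(T - s) B u(s) ds` of `D(A*)'` belongs to the pivot space `H`. -/
def IsAdmissible (S : C0Semigroup H) {A : H →ₗ.[ℂ] H} (hA : S.IsGeneratedBy A)
    (B : U →L[ℂ] AdjointDomainDual A) : Prop :=
  ∃ T : ℝ, 0 < T ∧ ∀ u : ControlSpace U, ∃ x : H, ∀ z : AdjointDomain A,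
    ⟪AdjointDomain.incl A z, x⟫_ℂ = inputFunctional S hA B T u z

/-- `Φ ∈ L(L²(0, +∞; U), H)` is the input map of `(A, B)` at time `T`:
`Φ u = ∫₀ᵀ S(T - s) B u(s) ds` in `D(A*)'`. -/
def IsInputMap (S : C0Semigroup H) {A : H →ₗ.[ℂ] H} (hA : S.IsGeneratedBy A)
    (B : U →L[ℂ] AdjointDomainDual A) (T : ℝ) (Φ : ControlSpace U →L[ℂ] H) : Prop :=
  ∀ (u : ControlSpace U) (z : AdjointDomain A),
    ⟪AdjointDomain.incl A z, Φ u⟫_ℂ = inputFunctional S hA B T u z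

/-- `V z̃(t) = ∫₀ᵗ S(t - s)* P* z̃(s) ds` with `z̃(s) = S(s)* z⁰`. -/
def volterra (S : C0Semigroup H) (P : H →L[ℂ] H) (z₀ : H) (t : ℝ) : H :=
  ∫ s in (0 : ℝ)..t, ContinuousLinearMap.adjoint (S.opAt (t - s))
    (ContinuousLinearMap.adjoint P (ContinuousLinearMap.adjoint (S.opAt s) z₀))

end Control

end

set_option linter.unusedSectionVars false

/-! For `z ∈ D(A₁*)` the adjoint input map is an output: `Φᵢ(T)* z` is the function `s ↦ B* Sᵢ(T -
s)* z` on `(0, T)`. After reversing time, `‖(Φ₁(T)* - Φ₂(T)*) z‖²` is therefore `∫₀ᵀ ‖B* S₂(t)* z -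
B* S₁(t)* z‖² dt`, called `diffEnergy`. It suffices to dominate this quantity by `Re ⟪R z, z⟫` with
`R` compact and nonnegative (`CompactlyDominated`): since `D(A₁*)` is dense, such a bound forces
`Φ₁(T)* - Φ₂(T)*` to be compact.

On short times, the variation of constants formula (`GenAt.opAt_sub_eq_dyson_add_conv`) gives
`S₂(t)* z - S₁(t)* z = V z̃(t) + ∫₀ᵗ S₂(t - s)* P* V z̃(s) ds`. The hypothesis bounds `B* V z̃(t)`
by `G(t) z`. In the second term `B*` cannot simply be moved under the integral, but admissibility is
equivalent to an observation inequality for `B* S(t)*`, which is stable under bounded perturbations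
(`ObsBound.perturbed`) and controls `B*` of convolutions in `L²` (`ObsBound.exists_conv_bound`). The
second term then costs at most a constant times `∫ ‖V z̃‖²`, again bounded through `G`. Hence the
energy of the difference on `(0, ε)` is at most a constant times `∫₀^ε ‖G(t) z‖² dt = ⟪R z, z⟫`,
where `R = ∫₀^ε G(t)* G(t) dt` is compact.

For long times, restart at time `τ`: the difference of outputs after `τ` is the difference of
outputs from the common state `S₁(τ)* z`, plus the `S₂`-output of the state error `(S₂(τ)* - S₁(τ)*)
z`. The first is handled by induction, the second by the observation inequality once `S₂(τ)* -
S₁(τ)*` is compact. The same formula in the norm of `H` shows this for almost every `τ ∈ (0, ε)`,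
and one such `τ` is enough. -/

noncomputable section

/-! ### Semigroups: growth bound, joint continuity, generator -/

section Basics

variable {H : Type*} [NormedAddCommGroup H] [InnerProductSpace ℂ H]

namespace C0Semigroup

variable (S : C0Semigroup H)

/-- `x` belongs to the domain of the generator of `S`, and the generator maps it to `y`. -/
def GenAt (x y : H) : Prop :=
  Tendsto (fun h : ℝ => h⁻¹ • (S.opAt h x - x)) (𝓝[>] 0) (𝓝 y)

theorem opAt_zero_apply (x : H) : S.opAt 0 x = x := by
  simp [opAt, S.map_zero']

theorem opAt_add_apply {s t : ℝ} (hs : 0 ≤ s) (ht : 0 ≤ t) (x : H) :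
    S.opAt (s + t) x = S.opAt s (S.opAt t x) := by
  simp [opAt, Real.toNNReal_add hs ht, S.map_add']

theorem opAt_comm {s t : ℝ} (hs : 0 ≤ s) (ht : 0 ≤ t) (x : H) :
    S.opAt s (S.opAt t x) = S.opAt t (S.opAt s x) := by
  rw [← S.opAt_add_apply hs ht, add_comm, S.opAt_add_apply ht hs]

theorem opAt_max (t : ℝ) : S.opAt (max t 0) = S.opAt t := by
  simp only [opAt]
  congr 1
  ext
  simp

theorem tendsto_opAt_zero (x : H) : Tendsto (fun t : ℝ => S.opAt t x) (𝓝 0) (𝓝 x) := by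
  have h : Tendsto Real.toNNReal (𝓝 0) (𝓝 0) := by
    simpa using continuous_real_toNNReal.tendsto 0
  exact (S.tendsto_zero' x).comp h

variable {S} in
theorem GenAt.map_opAt {x y : H} (h : S.GenAt x y) {t : ℝ} (ht : 0 ≤ t) :
    S.GenAt (S.opAt t x) (S.opAt t y) := by
  refine (((S.opAt t).continuous.tendsto _).comp h).congr' ?_
  filter_upwards [self_mem_nhdsWithin] with r hr
  rw [Function.comp_apply, S.opAt_comm (le_of_lt hr) ht, ← map_sub]
  exact ContinuousLinearMap.map_smul_of_tower (S.opAt t) (r⁻¹ : ℝ) _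

section

variable {S} {A : H →ₗ.[ℂ] H}

theorem IsGeneratedBy.genAt (hA : S.IsGeneratedBy A) (x : A.domain) : S.GenAt x (A x) :=
  (hA _ _).1 (A.mem_graph x)

theorem IsGeneratedBy.exists_of_genAt (hA : S.IsGeneratedBy A) {x y : H} (h : S.GenAt x y) :
    ∃ x' : A.domain, (x' : H) = x ∧ A x' = y := by
  have := (hA _ _).2 h
  rwa [LinearPMap.mem_graph_iff] at this

end

variable [CompleteSpace H]

/-- Otherwise `‖S(tₙ)‖ → ∞` along some `tₙ → 0`, which contradicts the uniform boundedness
principle, because `S(tₙ) x → x` for each `x`. -/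
theorem exists_bound_near_zero :
    ∃ δ > 0, ∃ M : ℝ, 1 ≤ M ∧ ∀ t ≤ δ, ‖S.opAt t‖ ≤ M := by
  by_contra! hcon
  have h1 : ∀ n : ℕ, ∃ t : ℝ, t ≤ 1 / ((n : ℝ) + 1) ∧ (n : ℝ) + 1 < ‖S.opAt t‖ := by
    intro n
    exact hcon _ (by positivity) _ (by linarith [n.cast_nonneg (α := ℝ)])
  choose t ht1 ht2 using h1
  -- The times `t n` have no lower bound, but `opAt` is constant on negative times, so they can be
  -- truncated at `0`.
  have hlim : Tendsto (fun n => max (t n) 0) atTop (𝓝 0) := by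
    refine squeeze_zero (fun n => le_max_right _ _) (fun n => ?_)
      (tendsto_one_div_add_atTop_nhds_zero_nat (𝕜 := ℝ))
    exact max_le (ht1 n) (by positivity)
  obtain ⟨C, hC⟩ := banach_steinhaus (g := fun n => S.opAt (t n)) (by
    intro x
    have h2 := ((S.tendsto_opAt_zero x).comp hlim).norm
    obtain ⟨C, hC⟩ := h2.bddAbove_range
    refine ⟨C, fun n => ?_⟩
    have := hC ⟨n, rfl⟩
    simpa [opAt_max] using this)
  obtain ⟨n, hn⟩ := exists_nat_gt C
  have := ht2 n
  have := hC n
  linarith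

theorem exists_exp_bound :
    ∃ M ω : ℝ, 1 ≤ M ∧ 0 ≤ ω ∧ ∀ t, 0 ≤ t → ‖S.opAt t‖ ≤ M * Real.exp (ω * t) := by
  obtain ⟨δ, hδ, M, hM, hb⟩ := S.exists_bound_near_zero
  have hind : ∀ n : ℕ, ∀ t : ℝ, 0 ≤ t → t ≤ (n + 1) * δ → ‖S.opAt t‖ ≤ M ^ (n + 1) := by
    intro n
    induction n with
    | zero => intro t _ ht; simpa using hb t (by simpa using ht)
    | succ n ih =>
      intro t ht0 ht
      rcases le_or_gt t δ with h | h
      · exact (hb t h).trans (le_self_pow₀ hM (by omega))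
      · have h1 := ih (t - δ) (by linarith) (by push_cast at ht; linarith)
        have h2 : S.opAt t = (S.opAt δ).comp (S.opAt (t - δ)) := by
          ext x
          rw [ContinuousLinearMap.comp_apply, ← S.opAt_add_apply hδ.le (by linarith)]
          congr 2
          ring
        rw [h2, pow_succ']
        exact (ContinuousLinearMap.opNorm_comp_le _ _).trans
          (mul_le_mul (hb δ le_rfl) h1 (norm_nonneg _) (by linarith))
  have hlog : 0 ≤ Real.log M := Real.log_nonneg hM
  -- `S(t)` is a product of at most `⌊t/δ⌋ + 1` factors of norm at most `M`, and `M ^ (t/δ) = exp (t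
  -- log M / δ)`.
  refine ⟨M, Real.log M / δ, hM, by positivity, fun t ht => ?_⟩
  have h1 := hind ⌊t / δ⌋₊ t ht (by
    have := Nat.lt_floor_add_one (t / δ)
    rw [div_lt_iff₀ hδ] at this
    exact this.le)
  refine h1.trans ?_
  rw [pow_succ']
  gcongr
  have h2 : M ^ ⌊t / δ⌋₊ = Real.exp (⌊t / δ⌋₊ * Real.log M) := by
    rw [Real.exp_nat_mul, Real.exp_log (by linarith)]
  rw [h2]
  apply Real.exp_le_exp.2
  have h3 : (⌊t / δ⌋₊ : ℝ) ≤ t / δ := Nat.floor_le (by positivity)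
  calc (⌊t / δ⌋₊ : ℝ) * Real.log M ≤ t / δ * Real.log M := by gcongr
    _ = Real.log M / δ * t := by ring

theorem exists_bound (T : ℝ) : ∃ M : ℝ, 1 ≤ M ∧ ∀ t ≤ T, ‖S.opAt t‖ ≤ M := by
  obtain ⟨M, ω, hM, hω, hb⟩ := S.exists_exp_bound
  have hT : 0 ≤ ω * max T 0 := mul_nonneg hω (le_max_right _ _)
  refine ⟨M * Real.exp (ω * max T 0), ?_, fun t ht => ?_⟩
  · nlinarith [Real.one_le_exp hT]
  · rw [← S.opAt_max]
    refine (hb _ (le_max_right _ _)).trans ?_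
    gcongr

/-- For `0 ≤ s ≤ t`, `S(t) x - S(s) x = S(s) (S(t - s) x - x)`. Factoring out the smaller time in
this way gives left and right continuity together from continuity at `0`. -/
theorem continuous_opAt_apply (x : H) : Continuous fun t : ℝ => S.opAt t x := by
  rw [continuous_iff_continuousAt]
  intro t₀
  obtain ⟨M, hM, hb⟩ := S.exists_bound (t₀ + 1)
  have key : ∀ s t : ℝ, s ≤ t → s ≤ t₀ + 1 →
      ‖S.opAt t x - S.opAt s x‖ ≤ M * ‖S.opAt (max t 0 - max s 0) x - x‖ := by
    intro s t hst hs
    have h1 : max s 0 ≤ max t 0 := max_le_max hst le_rfl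
    have h2 : S.opAt t x = S.opAt s (S.opAt (max t 0 - max s 0) x) := by
      rw [← S.opAt_max t, ← S.opAt_max s,
        ← S.opAt_add_apply (le_max_right _ _) (by linarith)]
      congr 2
      ring
    rw [h2, ← map_sub]
    exact (S.opAt s).le_of_opNorm_le (hb s hs) _
  have key2 : ∀ t : ℝ, t ≤ t₀ + 1 →
      ‖S.opAt t x - S.opAt t₀ x‖ ≤ M * ‖S.opAt |max t 0 - max t₀ 0| x - x‖ := by
    intro t ht
    rcases le_total t t₀ with h | h
    · have h1 : max t 0 ≤ max t₀ 0 := max_le_max h le_rfl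
      rw [norm_sub_rev, abs_of_nonpos (by linarith), neg_sub]
      exact key t t₀ h ht
    · have h1 : max t₀ 0 ≤ max t 0 := max_le_max h le_rfl
      rw [abs_of_nonneg (by linarith)]
      exact key t₀ t h (by linarith)
  have hlim : Tendsto (fun t : ℝ => M * ‖S.opAt |max t 0 - max t₀ 0| x - x‖) (𝓝 t₀) (𝓝 0) := by
    have h1 : Tendsto (fun t : ℝ => |max t 0 - max t₀ 0|) (𝓝 t₀) (𝓝 0) := by
      have : Continuous fun t : ℝ => |max t 0 - max t₀ 0| := by fun_prop
      simpa using this.tendsto t₀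
    have h2 := ((S.tendsto_opAt_zero x).comp h1).sub_const x
    simpa using (h2.norm.const_mul M)
  rw [ContinuousAt, tendsto_iff_norm_sub_tendsto_zero]
  refine squeeze_zero' (Eventually.of_forall fun t => norm_nonneg _) ?_ hlim
  filter_upwards [Iic_mem_nhds (show t₀ < t₀ + 1 by linarith)] with t ht using key2 t ht

theorem continuous_opAt {X : Type*} [TopologicalSpace X] {f : X → ℝ} {g : X → H}
    (hf : Continuous f) (hg : Continuous g) : Continuous fun p => S.opAt (f p) (g p) := by
  rw [continuous_iff_continuousAt]
  intro p₀
  obtain ⟨M, hM, hb⟩ := S.exists_bound (f p₀ + 1)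
  have h1 : ContinuousAt (fun p => S.opAt (f p) (g p₀)) p₀ :=
    ((S.continuous_opAt_apply (g p₀)).comp hf).continuousAt
  have h2 : Tendsto (fun p => S.opAt (f p) (g p - g p₀)) (𝓝 p₀) (𝓝 0) := by
    have h3 : Tendsto (fun p => M * ‖g p - g p₀‖) (𝓝 p₀) (𝓝 0) := by
      have : Continuous fun p => M * ‖g p - g p₀‖ := by fun_prop
      simpa using this.tendsto p₀
    refine squeeze_zero_norm' ?_ h3
    filter_upwards [hf.continuousAt.eventually
      (Iic_mem_nhds (show f p₀ < f p₀ + 1 by linarith))] with p hp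
    exact (S.opAt (f p)).le_of_opNorm_le (hb _ hp) _
  have h3 := h1.tendsto.add h2
  rw [add_zero] at h3
  refine h3.congr fun p => ?_
  rw [map_sub]
  abel

end C0Semigroup

/-- Averages over shrinking intervals `(0, h)`. -/
theorem tendsto_inv_smul_integral {E : Type*} [NormedAddCommGroup E] [NormedSpace ℝ E]
    [CompleteSpace E] {g : ℝ → ℝ → E} (hg : Continuous (Function.uncurry g)) :
    Tendsto (fun h : ℝ => h⁻¹ • ∫ s in (0 : ℝ)..h, g h s) (𝓝[>] 0) (𝓝 (g 0 0)) := by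
  rw [Metric.tendsto_nhds]
  intro ε hε
  have h1 : ∀ᶠ p : ℝ × ℝ in 𝓝 (0, 0), dist (g p.1 p.2) (g 0 0) < ε / 2 :=
    (Metric.tendsto_nhds.1 (hg.tendsto (0, 0))) (ε / 2) (by positivity)
  rw [Metric.eventually_nhds_iff] at h1
  obtain ⟨δ, hδ, hd⟩ := h1
  filter_upwards [Ioo_mem_nhdsGT hδ] with h hh
  have h2 : h⁻¹ • ∫ s in (0 : ℝ)..h, g h s = g 0 0 + h⁻¹ • ∫ s in (0 : ℝ)..h, (g h s - g 0 0) := by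
    rw [intervalIntegral.integral_sub]
    · rw [intervalIntegral.integral_const, smul_sub, smul_smul, sub_zero,
        inv_mul_cancel₀ hh.1.ne', one_smul]
      abel
    · exact (hg.comp (by fun_prop : Continuous fun s : ℝ => (h, s))).intervalIntegrable _ _
    · exact continuous_const.intervalIntegrable _ _
  rw [h2, dist_eq_norm, add_sub_cancel_left, norm_smul, norm_inv, Real.norm_of_nonneg hh.1.le]
  have h3 : ‖∫ s in (0 : ℝ)..h, (g h s - g 0 0)‖ ≤ ε / 2 * |h - 0| := by
    refine intervalIntegral.norm_integral_le_of_norm_le_const fun s hs => ?_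
    rw [uIoc_of_le hh.1.le] at hs
    rw [← dist_eq_norm]
    refine (hd (y := (h, s)) ?_).le
    rw [Prod.dist_eq, max_lt_iff]
    simp only [Real.dist_eq, sub_zero]
    rw [abs_of_pos hh.1, abs_of_pos hs.1]
    exact ⟨hh.2, hs.2.trans_lt hh.2⟩
  rw [sub_zero, abs_of_pos hh.1] at h3
  have h4 : h⁻¹ * ‖∫ s in (0 : ℝ)..h, (g h s - g 0 0)‖ ≤ h⁻¹ * (ε / 2 * h) := by
    have := hh.1
    gcongr
  have h5 : h⁻¹ * (ε / 2 * h) = ε / 2 := by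
    have := hh.1.ne'
    field_simp
  linarith

/-- A continuous function with a continuous right derivative is the integral of it. -/
theorem sub_eq_integral_of_tendsto_right {E : Type*} [NormedAddCommGroup E] [NormedSpace ℝ E]
    [CompleteSpace E] {y f : ℝ → E} {t : ℝ} (ht : 0 ≤ t) (hy : Continuous y) (hf : Continuous f)
    (h : ∀ s, 0 ≤ s → s < t →
      Tendsto (fun h : ℝ => h⁻¹ • (y (s + h) - y s)) (𝓝[>] 0) (𝓝 (f s))) :
    y t - y 0 = ∫ s in (0 : ℝ)..t, f s := by
  symm
  refine intervalIntegral.integral_eq_sub_of_hasDeriv_right_of_le ht hy.continuousOn ?_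
    (hf.intervalIntegrable _ _)
  intro s hs
  -- Generators only provide right derivatives, so the one-sided form of the fundamental theorem of
  -- calculus is used.
  rw [hasDerivWithinAt_iff_tendsto_slope' (by simp)]
  have h1 := h s hs.1.le hs.2
  have h2 : Tendsto (fun r : ℝ => r - s) (𝓝[>] s) (𝓝[>] 0) := by
    refine tendsto_nhdsWithin_iff.2 ⟨?_, ?_⟩
    · have : Continuous fun r : ℝ => r - s := by fun_prop
      simpa using (this.tendsto s).mono_left nhdsWithin_le_nhds
    · filter_upwards [self_mem_nhdsWithin] with r hr
      simpa using hr
  refine (h1.comp h2).congr fun r => ?_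
  simp [slope, vsub_eq_sub]

namespace C0Semigroup

variable [CompleteSpace H] (S : C0Semigroup H)

variable {S} in
theorem GenAt.opAt_sub_eq_integral {x y : H} (h : S.GenAt x y) {t : ℝ} (ht : 0 ≤ t) :
    S.opAt t x - x = ∫ s in (0 : ℝ)..t, S.opAt s y := by
  have h1 := sub_eq_integral_of_tendsto_right (y := fun s => S.opAt s x) ht
    (S.continuous_opAt_apply x) (S.continuous_opAt_apply y) (fun s hs _ => by
      refine (h.map_opAt hs).congr' ?_
      filter_upwards [self_mem_nhdsWithin] with r hr
      rw [← S.opAt_add_apply (le_of_lt hr) hs, add_comm])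
  rwa [S.opAt_zero_apply] at h1

theorem genAt_of_forall_integral {x y : H}
    (h : ∀ t, 0 < t → S.opAt t x - x = ∫ s in (0 : ℝ)..t, S.opAt s y) : S.GenAt x y := by
  have h1 := tendsto_inv_smul_integral (g := fun _ s => S.opAt s y)
    (S.continuous_opAt (by fun_prop) continuous_const)
  simp only [S.opAt_zero_apply] at h1
  refine h1.congr' ?_
  filter_upwards [self_mem_nhdsWithin] with r hr
  rw [h r hr]

/-- The operator `x ↦ ∫₀ᵗ S(s) x ds`. -/
def integ (t : ℝ) : H →L[ℂ] H :=
  LinearMap.mkContinuous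
    { toFun := fun x => ∫ s in (0 : ℝ)..t, S.opAt s x
      map_add' := fun x y => by
        simp only [map_add]
        exact intervalIntegral.integral_add ((S.continuous_opAt_apply x).intervalIntegrable _ _)
          ((S.continuous_opAt_apply y).intervalIntegrable _ _)
      map_smul' := fun c x => by
        simp only [map_smul, RingHom.id_apply]
        exact intervalIntegral.integral_smul c _ }
    ((S.exists_bound |t|).choose * |t|) (fun x => by
      have h1 := (S.exists_bound |t|).choose_spec.2
      have h2 := intervalIntegral.norm_integral_le_of_norm_le_const (a := 0) (b := t)
        (f := fun s => S.opAt s x) (C := (S.exists_bound |t|).choose * ‖x‖) (fun s hs => by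
          refine (S.opAt s).le_of_opNorm_le (h1 s ?_) _
          rcases le_total 0 t with h | h
          · rw [uIoc_of_le h] at hs
            exact hs.2.trans (le_abs_self t)
          · rw [uIoc_of_ge h] at hs
            exact hs.2.trans (abs_nonneg t))
      rw [sub_zero] at h2
      refine h2.trans (le_of_eq (by ring)))

theorem integ_apply (t : ℝ) (x : H) : S.integ t x = ∫ s in (0 : ℝ)..t, S.opAt s x := rfl

theorem tendsto_inv_smul_integ (x : H) :
    Tendsto (fun h : ℝ => h⁻¹ • S.integ h x) (𝓝[>] 0) (𝓝 x) := by
  have h1 := tendsto_inv_smul_integral (g := fun _ s => S.opAt s x)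
    (S.continuous_opAt (by fun_prop) continuous_const)
  rw [S.opAt_zero_apply] at h1
  exact h1

theorem opAt_integ {s : ℝ} (hs : 0 ≤ s) {t : ℝ} (ht : 0 ≤ t) (x : H) :
    S.opAt s (S.integ t x) = S.integ t (S.opAt s x) := by
  rw [integ_apply, integ_apply, ← ContinuousLinearMap.intervalIntegral_comp_comm]
  · refine intervalIntegral.integral_congr fun r hr => ?_
    rw [uIcc_of_le ht] at hr
    exact S.opAt_comm hs hr.1 x
  · exact (S.continuous_opAt_apply x).intervalIntegrable _ _

/-- By translation `S(a) ∫₀ᵇ S(s) x ds = ∫ₐ^{a+b} S(s) x ds`, so both sides equal `∫₀^{t+h} - ∫₀ᵗ -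
∫₀ʰ`, an expression symmetric in `t` and `h`. Exchanging the two lets the limit `h → 0` fall on
averages. -/
theorem opAt_integ_sub {t h : ℝ} (ht : 0 ≤ t) (hh : 0 ≤ h) (x : H) :
    S.opAt h (S.integ t x) - S.integ t x = S.opAt t (S.integ h x) - S.integ h x := by
  have hi : ∀ a b : ℝ, IntervalIntegrable (fun s => S.opAt s x) volume a b :=
    fun a b => (S.continuous_opAt_apply x).intervalIntegrable _ _
  have e : ∀ a b : ℝ, 0 ≤ a → 0 ≤ b →
      S.opAt a (S.integ b x) = ∫ s in a..(b + a), S.opAt s x := by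
    intro a b ha hb
    rw [integ_apply, ← ContinuousLinearMap.intervalIntegral_comp_comm _ (hi _ _)]
    have := intervalIntegral.integral_comp_add_right (a := 0) (b := b)
      (fun s => S.opAt s x) a
    rw [zero_add] at this
    rw [← this]
    refine intervalIntegral.integral_congr fun r hr => ?_
    rw [uIcc_of_le hb] at hr
    change S.opAt a (S.opAt r x) = S.opAt (r + a) x
    rw [add_comm, S.opAt_add_apply ha hr.1]
  rw [e h t hh ht, e t h ht hh, integ_apply, integ_apply, add_comm t h,
    ← intervalIntegral.integral_add_adjacent_intervals (hi h 0) (hi 0 (h + t)),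
    ← intervalIntegral.integral_add_adjacent_intervals (hi t 0) (hi 0 (h + t)),
    intervalIntegral.integral_symm 0 h, intervalIntegral.integral_symm 0 t]
  abel

theorem norm_integ_le {M T t : ℝ} (hM : ∀ s ≤ T, ‖S.opAt s‖ ≤ M) (ht : 0 ≤ t) (htT : t ≤ T) :
    ‖S.integ t‖ ≤ M * t := by
  have hM0 : 0 ≤ M := (norm_nonneg _).trans (hM T le_rfl)
  refine ContinuousLinearMap.opNorm_le_bound _ (by positivity) fun x => ?_
  have h2 := intervalIntegral.norm_integral_le_of_norm_le_const (a := 0) (b := t)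
    (f := fun s => S.opAt s x) (C := M * ‖x‖) (fun s hs => by
      rw [uIoc_of_le ht] at hs
      exact (S.opAt s).le_of_opNorm_le (hM s (hs.2.trans htT)) _)
  rw [sub_zero, abs_of_nonneg ht] at h2
  rw [integ_apply]
  linarith

theorem genAt_integ {t : ℝ} (ht : 0 ≤ t) (x : H) : S.GenAt (S.integ t x) (S.opAt t x - x) := by
  have h1 : Tendsto (fun h : ℝ => S.opAt t (h⁻¹ • S.integ h x) - h⁻¹ • S.integ h x) (𝓝[>] 0)
      (𝓝 (S.opAt t x - x)) :=
    (((S.opAt t).continuous.tendsto x).comp (S.tendsto_inv_smul_integ x)).sub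
      (S.tendsto_inv_smul_integ x)
  refine h1.congr' ?_
  filter_upwards [self_mem_nhdsWithin] with h hh
  rw [S.opAt_integ_sub ht (le_of_lt hh), smul_sub]
  congr 1
  exact ContinuousLinearMap.map_smul_of_tower (S.opAt t) (h⁻¹ : ℝ) _

variable {S} in
theorem IsGeneratedBy.dense {A : H →ₗ.[ℂ] H} (hA : S.IsGeneratedBy A) :
    Dense (A.domain : Set H) := by
  intro x
  refine mem_closure_of_tendsto (S.tendsto_inv_smul_integ x) ?_
  filter_upwards [self_mem_nhdsWithin] with h hh
  have h1 := (hA _ _).2 (S.genAt_integ (le_of_lt hh) x)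
  have h2 : S.integ h x ∈ A.domain := LinearPMap.mem_domain_of_mem_graph h1
  exact (A.domain.restrictScalars ℝ).smul_mem _ h2

end C0Semigroup

end Basics

/-! ### The adjoint semigroup and its generator `A*` -/

section Adjoint

variable {H : Type*} [NormedAddCommGroup H] [InnerProductSpace ℂ H] [CompleteSpace H]

namespace C0Semigroup

variable (S : C0Semigroup H)

/-- A vector `v` orthogonal to the span satisfies `‖∫₀ʰ S(s) v ds‖² = 0` for every `h > 0`; dividing
the integral by `h` and letting `h → 0` gives `v = 0`. -/
theorem dense_span_adjoint_integ :
    Dense (Submodule.span ℂ {v : H | ∃ h, 0 < h ∧ ∃ z, ContinuousLinearMap.adjoint (S.integ h) z = v}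
      : Set H) := by
  rw [Submodule.dense_iff_topologicalClosure_eq_top, Submodule.topologicalClosure_eq_top_iff,
    Submodule.eq_bot_iff]
  intro v hv
  have h1 : ∀ h : ℝ, 0 < h → S.integ h v = 0 := by
    intro h hh
    rw [← inner_self_eq_zero (𝕜 := ℂ), ← ContinuousLinearMap.adjoint_inner_left]
    exact (Submodule.mem_orthogonal _ v).1 hv _ (Submodule.subset_span ⟨h, hh, _, rfl⟩)
  refine tendsto_nhds_unique (S.tendsto_inv_smul_integ v) ?_
  refine tendsto_const_nhds.congr' ?_
  filter_upwards [self_mem_nhdsWithin] with h hh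
  rw [h1 h hh, smul_zero]

/-- On a smoothed vector `k = (∫₀ʰ S)* z` one has `(S(t)* - 1) k = (∫₀ᵗ S)* (S(h)* - 1) z`, of norm
`O(t)`. Density of the span of such vectors and the local bound on `‖S(t)‖` do the rest. -/
theorem tendsto_adjoint_opAt_zero (z : H) :
    Tendsto (fun t : ℝ => ContinuousLinearMap.adjoint (S.opAt t) z) (𝓝[≥] 0) (𝓝 z) := by
  obtain ⟨M, hM, hb⟩ := S.exists_bound 1
  have hspan : ∀ k ∈ Submodule.span ℂ
      {v : H | ∃ h, 0 < h ∧ ∃ z, ContinuousLinearMap.adjoint (S.integ h) z = v},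
      Tendsto (fun t : ℝ => ContinuousLinearMap.adjoint (S.opAt t) k) (𝓝[≥] 0) (𝓝 k) := by
    intro k hk
    induction hk using Submodule.span_induction with
    | mem k hk =>
      obtain ⟨h, hh, z, rfl⟩ := hk
      rw [tendsto_iff_norm_sub_tendsto_zero]
      have hlim : Tendsto (fun t : ℝ => M * t *
          ‖ContinuousLinearMap.adjoint (S.opAt h) z - z‖) (𝓝[≥] 0) (𝓝 0) := by
        have : Continuous fun t : ℝ => M * t *
          ‖ContinuousLinearMap.adjoint (S.opAt h) z - z‖ := by fun_prop
        simpa using (this.tendsto 0).mono_left nhdsWithin_le_nhds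
      refine squeeze_zero' (Eventually.of_forall fun t => norm_nonneg _) ?_ hlim
      filter_upwards [self_mem_nhdsWithin,
        mem_nhdsWithin_of_mem_nhds (Iic_mem_nhds (zero_lt_one' ℝ))] with t ht ht1
      have e : ContinuousLinearMap.adjoint (S.opAt t) (ContinuousLinearMap.adjoint (S.integ h) z)
          - ContinuousLinearMap.adjoint (S.integ h) z
          = ContinuousLinearMap.adjoint (S.integ t)
            (ContinuousLinearMap.adjoint (S.opAt h) z - z) := by
        refine ext_inner_right ℂ fun x => ?_
        simp only [inner_sub_left, map_sub, ContinuousLinearMap.adjoint_inner_left]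
        rw [← inner_sub_right, ← inner_sub_right, ← S.opAt_integ ht hh.le,
          S.opAt_integ_sub hh.le ht]
      rw [e]
      refine ContinuousLinearMap.le_of_opNorm_le _ ?_ _
      rw [LinearIsometryEquiv.norm_map]
      exact S.norm_integ_le hb ht ht1
    | zero => simp
    | add x y _ _ hx hy => simpa only [map_add] using hx.add hy
    | smul a x _ hx => simpa only [map_smul] using hx.const_smul a
  rw [Metric.tendsto_nhds]
  intro ε hε
  obtain ⟨k, hk, hkz⟩ := Metric.mem_closure_iff.1 (S.dense_span_adjoint_integ z)
    (ε / (2 * (M + 1))) (by positivity)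
  filter_upwards [Metric.tendsto_nhds.1 (hspan k hk) (ε / 2) (by positivity),
    mem_nhdsWithin_of_mem_nhds (Iic_mem_nhds (zero_lt_one' ℝ))] with t ht ht1
  rw [dist_eq_norm] at *
  have e : ContinuousLinearMap.adjoint (S.opAt t) z - z
      = ContinuousLinearMap.adjoint (S.opAt t) (z - k)
        + (ContinuousLinearMap.adjoint (S.opAt t) k - k) - (z - k) := by
    rw [map_sub]
    abel
  have h1 : ‖ContinuousLinearMap.adjoint (S.opAt t) (z - k)‖ ≤ M * ‖z - k‖ := by
    refine ContinuousLinearMap.le_of_opNorm_le _ ?_ _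
    rw [LinearIsometryEquiv.norm_map]
    exact hb t ht1
  have h2 : ‖z - k‖ * (2 * (M + 1)) < ε := by rwa [lt_div_iff₀ (by positivity)] at hkz
  rw [e]
  have h3 := norm_sub_le (ContinuousLinearMap.adjoint (S.opAt t) (z - k)
        + (ContinuousLinearMap.adjoint (S.opAt t) k - k)) (z - k)
  have h4 := norm_add_le (ContinuousLinearMap.adjoint (S.opAt t) (z - k))
        (ContinuousLinearMap.adjoint (S.opAt t) k - k)
  linarith

/-- The adjoint semigroup `t ↦ S(t)*`. -/
def adj : C0Semigroup H where
  toFun t := ContinuousLinearMap.adjoint (S.toFun t)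
  map_zero' := by
    rw [S.map_zero']
    exact ContinuousLinearMap.adjoint_id
  map_add' s t := by
    rw [add_comm, S.map_add', ContinuousLinearMap.adjoint_comp]
  tendsto_zero' x := by
    have h1 : Tendsto (fun t : ℝ≥0 => (t : ℝ)) (𝓝 0) (𝓝[≥] 0) := by
      refine tendsto_nhdsWithin_iff.2 ⟨?_, Eventually.of_forall fun t => t.2⟩
      simpa using NNReal.continuous_coe.tendsto 0
    refine ((S.tendsto_adjoint_opAt_zero x).comp h1).congr fun t => ?_
    simp [opAt]

theorem adj_opAt (t : ℝ) : S.adj.opAt t = ContinuousLinearMap.adjoint (S.opAt t) := rfl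

variable {S} {A : H →ₗ.[ℂ] H}

/-- Testing against `x`: `⟪S(t)* w - w, x⟫ = ⟪w, A ∫₀ᵗ S(s) x ds⟫ = ⟪A* w, ∫₀ᵗ S(s) x ds⟫`, which is
the integrated form of `d/dt S(t)* w = S(t)* A* w`. With `IsGeneratedBy.exists_of_adj_genAt` it
identifies the generator of the adjoint semigroup as `A*`. -/
theorem IsGeneratedBy.adj_genAt (hA : S.IsGeneratedBy A) (w : AdjointDomain A) :
    S.adj.GenAt (AdjointDomain.incl A w) (AdjointDomain.op A w) := by
  refine S.adj.genAt_of_forall_integral fun t ht => ?_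
  refine ext_inner_right ℂ fun x => ?_
  obtain ⟨x', hx1, hx2⟩ := hA.exists_of_genAt (S.genAt_integ ht.le x)
  have h1 : ⟪AdjointDomain.op A w, (x' : H)⟫_ℂ = ⟪AdjointDomain.incl A w, A x'⟫_ℂ :=
    LinearPMap.adjoint_isFormalAdjoint hA.dense w x'
  rw [hx1, hx2] at h1
  have hc : IntervalIntegrable (fun s => S.adj.opAt s (AdjointDomain.op A w)) volume 0 t :=
    (S.adj.continuous_opAt_apply _).intervalIntegrable _ _
  have hc' : IntervalIntegrable (fun s => S.opAt s x) volume 0 t :=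
    (S.continuous_opAt_apply _).intervalIntegrable _ _
  rw [adj_opAt, inner_sub_left, ContinuousLinearMap.adjoint_inner_left, ← inner_sub_right, ← h1,
    integ_apply, ← inner_conj_symm (∫ s in (0 : ℝ)..t, S.adj.opAt s (AdjointDomain.op A w)) x]
  have e1 := (innerSL ℂ x).intervalIntegral_comp_comm hc
  have e2 := (innerSL ℂ (AdjointDomain.op A w)).intervalIntegral_comp_comm hc'
  simp only [innerSL_apply_apply] at e1 e2
  rw [← e1, ← e2]
  -- The integral over the adjoint semigroup sits in the conjugate-linear slot, so conjugation has
  -- to be taken through the integral as a real-linear map.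
  have e3 := Complex.conjCLE.toContinuousLinearMap.intervalIntegral_comp_comm
    (((innerSL ℂ x).continuous.comp
      (S.adj.continuous_opAt_apply (AdjointDomain.op A w))).intervalIntegrable
        (μ := volume) 0 t)
  simp only [Function.comp_apply, innerSL_apply_apply] at e3
  refine Eq.trans ?_ e3
  refine intervalIntegral.integral_congr fun s _ => ?_
  change ⟪AdjointDomain.op A w, S.opAt s x⟫_ℂ
    = (starRingEnd ℂ) ⟪x, S.adj.opAt s (AdjointDomain.op A w)⟫_ℂ
  rw [inner_conj_symm, adj_opAt, ContinuousLinearMap.adjoint_inner_left]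

theorem IsGeneratedBy.exists_of_adj_genAt (hA : S.IsGeneratedBy A) {z y : H}
    (h : S.adj.GenAt z y) :
    ∃ w : AdjointDomain A, AdjointDomain.incl A w = z ∧ AdjointDomain.op A w = y := by
  have key : ∀ x : A.domain, ⟪y, (x : H)⟫_ℂ = ⟪z, A x⟫_ℂ := by
    intro x
    have h1 := ((continuous_id.inner (𝕜 := ℂ) (continuous_const (y := (x : H)))).tendsto y).comp h
    have h2 := (((continuous_const (y := z)).inner (𝕜 := ℂ) continuous_id).tendsto (A x)).comp
      (hA.genAt x)
    refine tendsto_nhds_unique h1 (h2.congr fun r => ?_)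
    simp only [Function.comp_apply, id_eq]
    rw [← Complex.coe_smul, ← Complex.coe_smul, inner_smul_left, inner_smul_right,
      Complex.conj_ofReal, inner_sub_left, inner_sub_right, adj_opAt,
      ContinuousLinearMap.adjoint_inner_left]
  exact ⟨⟨z, LinearPMap.mem_adjoint_domain_of_exists _ ⟨y, key⟩⟩, rfl,
      LinearPMap.adjoint_apply_eq hA.dense _ key⟩

theorem IsGeneratedBy.denseRange_incl (hA : S.IsGeneratedBy A) :
    DenseRange (AdjointDomain.incl A) := by
  intro z
  refine mem_closure_of_tendsto (S.adj.tendsto_inv_smul_integ z) ?_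
  filter_upwards [self_mem_nhdsWithin] with h hh
  obtain ⟨w, hw, -⟩ := hA.exists_of_adj_genAt (S.adj.genAt_integ (le_of_lt hh) z)
  refine ⟨(h⁻¹ : ℂ) • w, ?_⟩
  rw [map_smul, hw, ← Complex.coe_smul, Complex.ofReal_inv]

end C0Semigroup

end Adjoint

/-! ### Convolutions and bounded perturbations of generators -/

section Perturbation

variable {H : Type*} [NormedAddCommGroup H] [InnerProductSpace ℂ H] [CompleteSpace H]

namespace C0Semigroup

variable (S : C0Semigroup H)

/-- The convolution `∫₀ᵗ S(t - s) g(s) ds`. -/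
def conv (g : ℝ → H) (t : ℝ) : H := ∫ s in (0 : ℝ)..t, S.opAt (t - s) (g s)

theorem conv_zero (g : ℝ → H) : S.conv g 0 = 0 := intervalIntegral.integral_same

theorem continuous_conv {g : ℝ → H} (hg : Continuous g) : Continuous (S.conv g) :=
  intervalIntegral.continuous_parametric_intervalIntegral_of_continuous
    (f := fun t s => S.opAt (t - s) (g s))
    (S.continuous_opAt (by fun_prop) (hg.comp continuous_snd)) continuous_id

theorem intervalIntegrable_conv {g : ℝ → H} (hg : Continuous g) (t a b : ℝ) :
    IntervalIntegrable (fun s => S.opAt (t - s) (g s)) volume a b :=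
  (S.continuous_opAt (by fun_prop) hg).intervalIntegrable _ _

theorem conv_congr {f g : ℝ → H} {t : ℝ} (ht : 0 ≤ t) (h : ∀ s, 0 ≤ s → s ≤ t → f s = g s) :
    S.conv f t = S.conv g t := by
  refine intervalIntegral.integral_congr fun s hs => ?_
  rw [uIcc_of_le ht] at hs
  simp only [h s hs.1 hs.2]

theorem conv_add_time {g : ℝ → H} (hg : Continuous g) {s t : ℝ} (hs : 0 ≤ s) (ht : 0 ≤ t) :
    S.conv g (t + s) = S.opAt t (S.conv g s) + S.conv (fun r => g (r + s)) t := by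
  have h1 : S.opAt t (S.conv g s) = ∫ r in (0 : ℝ)..s, S.opAt (t + s - r) (g r) := by
    rw [conv, ← ContinuousLinearMap.intervalIntegral_comp_comm _
      (S.intervalIntegrable_conv hg _ _ _)]
    refine intervalIntegral.integral_congr fun r hr => ?_
    rw [uIcc_of_le hs] at hr
    change S.opAt t (S.opAt (s - r) (g r)) = _
    rw [← S.opAt_add_apply ht (by linarith [hr.2])]
    congr 2
    ring
  have h2 : S.conv (fun r => g (r + s)) t = ∫ r in s..(t + s), S.opAt (t + s - r) (g r) := by
    have := intervalIntegral.integral_comp_add_right (a := 0) (b := t)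
      (fun r => S.opAt (t + s - r) (g r)) s
    rw [zero_add] at this
    rw [← this, conv]
    refine intervalIntegral.integral_congr fun r _ => ?_
    congr 2
    ring
  rw [h1, h2, intervalIntegral.integral_add_adjacent_intervals] <;> first
    | rfl
    | exact S.intervalIntegrable_conv hg _ _ _

theorem tendsto_inv_smul_conv {g : ℝ → H} (hg : Continuous g) :
    Tendsto (fun h : ℝ => h⁻¹ • S.conv g h) (𝓝[>] 0) (𝓝 (g 0)) := by
  have h1 := tendsto_inv_smul_integral (g := fun h s => S.opAt (h - s) (g s))
    (S.continuous_opAt (by fun_prop) (hg.comp continuous_snd))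
  rw [sub_zero, opAt_zero_apply] at h1
  exact h1

theorem integral_exp_neg_le {l : ℝ} (hl : 0 < l) (t : ℝ) :
    ∫ s in (0 : ℝ)..t, Real.exp (-l * (t - s)) ≤ 1 / l := by
  have h1 : ∀ s ∈ uIcc 0 t, HasDerivAt (fun s => Real.exp (-l * (t - s)) / l)
      (Real.exp (-l * (t - s))) s := by
    intro s _
    have h2 : HasDerivAt (fun s => -l * (t - s)) l s := by
      simpa using ((hasDerivAt_id s).const_sub t).const_mul (-l)
    have h3 := h2.exp.div_const l
    rwa [mul_div_cancel_right₀ _ hl.ne'] at h3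
  rw [intervalIntegral.integral_eq_sub_of_hasDerivAt h1
    ((by fun_prop : Continuous fun s => Real.exp (-l * (t - s))).intervalIntegrable _ _)]
  have h4 : 0 < Real.exp (-l * (t - 0)) / l := by positivity
  simp only [sub_self, mul_zero, Real.exp_zero]
  linarith

theorem norm_conv_le_of_decay {M l : ℝ} (hl : 0 < l) (hM : 0 ≤ M)
    (hb : ∀ t, 0 ≤ t → ‖S.opAt t‖ ≤ M * Real.exp (-l * t)) {g : ℝ → H} {c : ℝ}
    (hc : ∀ t, ‖g t‖ ≤ c) {t : ℝ} (ht : 0 ≤ t) : ‖S.conv g t‖ ≤ M * c / l := by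
  have hc0 : 0 ≤ c := (norm_nonneg _).trans (hc 0)
  have h1 : ‖S.conv g t‖ ≤ ∫ s in (0 : ℝ)..t, M * c * Real.exp (-l * (t - s)) := by
    refine intervalIntegral.norm_integral_le_of_norm_le ht (Eventually.of_forall fun s hs => ?_)
      ((by fun_prop : Continuous fun s => M * c * Real.exp (-l * (t - s))).intervalIntegrable _ _)
    calc ‖S.opAt (t - s) (g s)‖ ≤ (M * Real.exp (-l * (t - s))) * c :=
          ContinuousLinearMap.le_of_opNorm_le_of_le _ (hb _ (by linarith [hs.2])) (hc s)
      _ = M * c * Real.exp (-l * (t - s)) := by ring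
  refine h1.trans ?_
  rw [intervalIntegral.integral_const_mul]
  calc M * c * ∫ s in (0 : ℝ)..t, Real.exp (-l * (t - s)) ≤ M * c * (1 / l) := by
        gcongr
        exact integral_exp_neg_le hl t
    _ = M * c / l := by ring

open BoundedContinuousFunction in
-- With decay, `f ↦ ∫₀ᵗ S(t - s) P f(s) ds` acts on bounded continuous functions on the half-line
-- with norm at most `M ‖P‖ / l < 1`. A Neumann series thus solves the fixed point equation globally
-- in time, with a unique bounded solution.
theorem exists_perturbed_of_decay (P : H →L[ℂ] H) {M l : ℝ} (hl : 0 < l) (hM : 0 ≤ M)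
    (hb : ∀ t, 0 ≤ t → ‖S.opAt t‖ ≤ M * Real.exp (-l * t)) (hP : M * ‖P‖ < l) :
    ∃ S' : C0Semigroup H, ∀ (x : H) (t : ℝ), 0 ≤ t →
      S'.opAt t x = S.opAt t x + S.conv (fun s => P (S'.opAt s x)) t := by
  have hb' : ∀ t, 0 ≤ t → ‖S.opAt t‖ ≤ M := fun t ht => (hb t ht).trans <| by
    have : Real.exp (-l * t) ≤ 1 := Real.exp_le_one_iff.2 (by nlinarith)
    nlinarith
  let J : H →L[ℂ] (ℝ≥0 →ᵇ H) := LinearMap.mkContinuous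
    { toFun := fun x => ofNormedAddCommGroup (fun t : ℝ≥0 => S.opAt t x)
        ((S.continuous_opAt_apply x).comp NNReal.continuous_coe) (M * ‖x‖)
        (fun t => (S.opAt t).le_of_opNorm_le (hb' t t.2) x)
      map_add' := fun x y => by ext t; simp
      map_smul' := fun c x => by ext t; simp } M
    (fun x => (BoundedContinuousFunction.norm_le (by positivity)).2 fun t =>
      (S.opAt t).le_of_opNorm_le (hb' t t.2) x)
  have hJ : ∀ x (t : ℝ≥0), J x t = S.opAt t x := fun x t => rfl
  have hcont : ∀ f : ℝ≥0 →ᵇ H, Continuous fun s : ℝ => P (f s.toNNReal) := fun f =>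
    P.continuous.comp (f.continuous.comp continuous_real_toNNReal)
  have hVb : ∀ (f : ℝ≥0 →ᵇ H) (t : ℝ≥0),
      ‖S.conv (fun s => P (f s.toNNReal)) t‖ ≤ M * ‖P‖ / l * ‖f‖ := fun f t => by
    refine (S.norm_conv_le_of_decay hl hM hb (c := ‖P‖ * ‖f‖)
      (fun s => P.le_opNorm_of_le (f.norm_coe_le_norm _)) t.2).trans (le_of_eq (by ring))
  let V : (ℝ≥0 →ᵇ H) →L[ℂ] (ℝ≥0 →ᵇ H) := LinearMap.mkContinuous
    { toFun := fun f => ofNormedAddCommGroup (fun t : ℝ≥0 => S.conv (fun s => P (f s.toNNReal)) t)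
        ((S.continuous_conv (hcont f)).comp NNReal.continuous_coe) _ (hVb f)
      map_add' := fun f g => by
        ext t
        simp only [coe_ofNormedAddCommGroup, BoundedContinuousFunction.add_apply, map_add, conv]
        exact intervalIntegral.integral_add (S.intervalIntegrable_conv (hcont f) _ _ _)
          (S.intervalIntegrable_conv (hcont g) _ _ _)
      map_smul' := fun c f => by
        ext t
        simp only [coe_ofNormedAddCommGroup, BoundedContinuousFunction.coe_smul, map_smul, conv,
          RingHom.id_apply]
        exact intervalIntegral.integral_smul c _ } (M * ‖P‖ / l)
    (fun f => (BoundedContinuousFunction.norm_le (by positivity)).2 (hVb f))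
  have hV : ∀ f (t : ℝ≥0), V f t = S.conv (fun s => P (f s.toNNReal)) t := fun f t => rfl
  have hVn : ‖V‖ < 1 := by
    refine (LinearMap.mkContinuous_norm_le _ (by positivity) _).trans_lt ?_
    rwa [div_lt_one hl]
  let u := Units.oneSub V hVn
  let R : (ℝ≥0 →ᵇ H) →L[ℂ] (ℝ≥0 →ᵇ H) := ((u⁻¹ : ((ℝ≥0 →ᵇ H) →L[ℂ] (ℝ≥0 →ᵇ H))ˣ) :
    (ℝ≥0 →ᵇ H) →L[ℂ] (ℝ≥0 →ᵇ H))
  have hu : (u : (ℝ≥0 →ᵇ H) →L[ℂ] (ℝ≥0 →ᵇ H)) = 1 - V := rfl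
  have hR1 : ∀ f, R f = f + V (R f) := by
    intro f
    have h1 : (1 - V) (R f) = f := by
      rw [← hu]
      exact DFunLike.congr_fun (u.mul_inv) f
    rw [_root_.sub_apply, one_apply_eq_self] at h1
    exact eq_add_of_sub_eq h1
  -- Uniqueness of the fixed point, from which the semigroup law follows.
  have hR2 : ∀ f g, g = f + V g → g = R f := by
    intro f g h
    have h1 : R ((1 - V) g) = g := by
      rw [← hu]
      exact DFunLike.congr_fun (u.inv_mul) g
    rw [_root_.sub_apply, one_apply_eq_self] at h1
    have h2 : g - V g = f := sub_eq_of_eq_add h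
    rw [← h1, h2]
  have hval : ∀ x (t : ℝ≥0), R (J x) t
      = S.opAt t x + S.conv (fun s => P (R (J x) s.toNNReal)) t := fun x t => by
    have h := DFunLike.congr_fun (hR1 (J x)) t
    rwa [BoundedContinuousFunction.add_apply, hJ, hV] at h
  have hzero : ∀ x, R (J x) 0 = x := fun x => by
    rw [hval, NNReal.coe_zero, S.opAt_zero_apply, S.conv_zero, add_zero]
  have hadd : ∀ x (s t : ℝ≥0), R (J x) (t + s) = R (J (R (J x) s)) t := by
    intro x s t
    -- The orbit shifted by `s` solves the same equation, started from the value of the orbit at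
    -- time `s`.
    let σ : ℝ≥0 →ᵇ H := (R (J x)).compContinuous ⟨fun t => t + s, by fun_prop⟩
    have hσ : ∀ t, σ t = R (J x) (t + s) := fun t => rfl
    have h1 : σ = J (R (J x) s) + V σ := by
      ext r
      rw [BoundedContinuousFunction.add_apply, hJ, hV, hσ, hval, NNReal.coe_add,
        S.conv_add_time (hcont (R (J x))) s.coe_nonneg r.coe_nonneg,
        S.opAt_add_apply r.coe_nonneg s.coe_nonneg, ← add_assoc, ← map_add,
        ← hval]
      congr 1
      refine S.conv_congr r.2 fun q hq _ => ?_
      rw [hσ, Real.toNNReal_add hq s.coe_nonneg, Real.toNNReal_coe]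
    rw [← hσ, hR2 _ _ h1]
  refine ⟨{ toFun := fun t => (BoundedContinuousFunction.evalCLM ℂ t).comp (R.comp J)
            map_zero' := by
              ext x
              exact hzero x
            map_add' := fun s t => by
              ext x
              exact hadd x t s
            tendsto_zero' := fun x => by
              have := (R (J x)).continuous.tendsto 0
              rwa [hzero] at this }, fun x t ht => ?_⟩
  have h1 := hval x t.toNNReal
  rw [Real.coe_toNNReal t ht] at h1
  exact h1

/-- The rescaled semigroup `t ↦ exp(c t) S(t)`. -/
def rescale (c : ℝ) : C0Semigroup H where
  toFun t := (Real.exp (c * t) : ℂ) • S.toFun t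
  map_zero' := by simp [S.map_zero']
  map_add' s t := by
    ext x
    simp only [S.map_add', NNReal.coe_add, mul_add, Real.exp_add, Complex.ofReal_mul,
      smul_apply, ContinuousLinearMap.comp_apply, map_smul, smul_smul]
    rw [mul_comm]
  tendsto_zero' x := by
    have h1 : Continuous fun t : ℝ≥0 => (Real.exp (c * t) : ℂ) := by fun_prop
    simpa using (h1.tendsto 0).smul (S.tendsto_zero' x)

theorem rescale_opAt {c t : ℝ} (ht : 0 ≤ t) (x : H) :
    (S.rescale c).opAt t x = (Real.exp (c * t) : ℂ) • S.opAt t x := by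
  change ((Real.exp (c * t.toNNReal) : ℂ) • S.toFun t.toNNReal) x = _
  rw [Real.coe_toNNReal t ht]
  rfl

theorem exists_perturbed (P : H →L[ℂ] H) :
    ∃ S' : C0Semigroup H, ∀ (x : H) (t : ℝ), 0 ≤ t →
      S'.opAt t x = S.opAt t x + S.conv (fun s => P (S'.opAt s x)) t := by
  obtain ⟨M, ω, hM, hω, hb⟩ := S.exists_exp_bound
  -- Multiplying by `exp (c t)` with `c = -(M ‖P‖ + 1) - ω` replaces the growth rate `ω` by the
  -- decay rate `M ‖P‖ + 1`, which exceeds `M ‖P‖` as the previous lemma requires. The fixed point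
  -- equation is invariant under this rescaling.
  have hl : 0 < M * ‖P‖ + 1 := by positivity
  obtain ⟨S', hS'⟩ := (S.rescale (-(M * ‖P‖ + 1) - ω)).exists_perturbed_of_decay P hl
    (by linarith : 0 ≤ M) (fun t ht => by
      refine ContinuousLinearMap.opNorm_le_bound _ (by positivity) fun x => ?_
      rw [S.rescale_opAt ht, norm_smul, Complex.norm_real, Real.norm_of_nonneg (Real.exp_pos _).le]
      have h1 := (S.opAt t).le_of_opNorm_le (hb t ht) x
      calc Real.exp ((-(M * ‖P‖ + 1) - ω) * t) * ‖S.opAt t x‖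
          ≤ Real.exp ((-(M * ‖P‖ + 1) - ω) * t) * (M * Real.exp (ω * t) * ‖x‖) := by gcongr
        _ = M * (Real.exp ((-(M * ‖P‖ + 1) - ω) * t) * Real.exp (ω * t)) * ‖x‖ := by ring
        _ = M * Real.exp (-(M * ‖P‖ + 1) * t) * ‖x‖ := by
          rw [← Real.exp_add]
          congr 3
          ring) (by linarith)
  set c := -(M * ‖P‖ + 1) - ω
  refine ⟨S'.rescale (-c), fun x t ht => ?_⟩
  have hcancel : (Real.exp (-c * t) : ℂ) * (Real.exp (c * t) : ℂ) = 1 := by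
    rw [← Complex.ofReal_mul, ← Real.exp_add]
    simp
  rw [S'.rescale_opAt ht, hS' x t ht, S.rescale_opAt ht, smul_add, smul_smul, hcancel, one_smul]
  congr 1
  rw [conv, conv, ← intervalIntegral.integral_smul]
  refine intervalIntegral.integral_congr fun s hs => ?_
  rw [uIcc_of_le ht] at hs
  rw [S.rescale_opAt (by linarith [hs.2]), S'.rescale_opAt hs.1, map_smul, map_smul, smul_smul]
  congr 1
  rw [← Complex.ofReal_mul, ← Real.exp_add]
  congr 2
  ring

variable {S} {A : H →ₗ.[ℂ] H}

/-- The difference quotients of `S'` and `S` at `x` differ by `r⁻¹ ∫₀ʳ S(r - s) P S'(s) x ds`, which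
tends to `P x`. So the two converge together, and the domains agree exactly. -/
theorem genAt_perturbed_iff {S S' : C0Semigroup H} {P : H →L[ℂ] H}
    (h : ∀ (x : H) (t : ℝ), 0 ≤ t →
      S'.opAt t x = S.opAt t x + S.conv (fun s => P (S'.opAt s x)) t) (x y : H) :
    S'.GenAt x (y + P x) ↔ S.GenAt x y := by
  have h1 : Tendsto (fun r : ℝ => r⁻¹ • S.conv (fun s => P (S'.opAt s x)) r) (𝓝[>] 0)
      (𝓝 (P x)) := by
    have := S.tendsto_inv_smul_conv (P.continuous.comp (S'.continuous_opAt_apply x))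
    rwa [Function.comp_apply, opAt_zero_apply] at this
  have e : ∀ r : ℝ, 0 < r → r⁻¹ • (S'.opAt r x - x)
      = r⁻¹ • (S.opAt r x - x) + r⁻¹ • S.conv (fun s => P (S'.opAt s x)) r := by
    intro r hr
    rw [← smul_add]
    congr 1
    rw [h x r hr.le]
    abel
  constructor
  · intro h2
    have h3 := Tendsto.sub h2 h1
    rw [add_sub_cancel_right] at h3
    refine h3.congr' ?_
    filter_upwards [self_mem_nhdsWithin] with r hr
    rw [e r hr, add_sub_cancel_right]
  · intro h2
    refine (Tendsto.add h2 h1).congr' ?_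
    filter_upwards [self_mem_nhdsWithin] with r hr
    rw [e r hr]

theorem mem_graph_boundedPerturbation (A : H →ₗ.[ℂ] H) (P : H →L[ℂ] H) (x y : H) :
    (x, y) ∈ (A.boundedPerturbation P).graph ↔ (x, y - P x) ∈ A.graph := by
  rw [LinearPMap.mem_graph_iff, LinearPMap.mem_graph_iff]
  constructor
  · rintro ⟨x', rfl, hx⟩
    exact ⟨x', rfl, eq_sub_of_add_eq hx⟩
  · rintro ⟨x', rfl, hx⟩
    exact ⟨x', rfl, add_eq_of_eq_sub hx⟩

theorem IsGeneratedBy.exists_boundedPerturbation (hA : S.IsGeneratedBy A) (P : H →L[ℂ] H) :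
    ∃ S' : C0Semigroup H, S'.IsGeneratedBy (A.boundedPerturbation P) := by
  obtain ⟨S', hS'⟩ := S.exists_perturbed P
  refine ⟨S', fun x y => ?_⟩
  rw [mem_graph_boundedPerturbation, hA]
  have := genAt_perturbed_iff hS' x (y - P x)
  rw [sub_add_cancel] at this
  exact this.symm

end C0Semigroup

end Perturbation

/-! ### Variation of constants and the first Dyson–Phillips term -/

section Duhamel

variable {H : Type*} [NormedAddCommGroup H] [InnerProductSpace ℂ H] [CompleteSpace H]

namespace C0Semigroup

variable (S : C0Semigroup H)

/-- The first Dyson–Phillips term `x ↦ ∫₀ᵗ S(t - s) Q S(s) x ds`. -/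
def dyson (Q : H →L[ℂ] H) (t : ℝ) : H →L[ℂ] H :=
  LinearMap.mkContinuous
    { toFun := fun x => S.conv (fun s => Q (S.opAt s x)) t
      map_add' := fun x y => by
        simp only [map_add, conv]
        exact intervalIntegral.integral_add
          (S.intervalIntegrable_conv (Q.continuous.comp (S.continuous_opAt_apply x)) _ _ _)
          (S.intervalIntegrable_conv (Q.continuous.comp (S.continuous_opAt_apply y)) _ _ _)
      map_smul' := fun c x => by
        simp only [map_smul, RingHom.id_apply, conv]
        exact intervalIntegral.integral_smul c _ }
    ((S.exists_bound |t|).choose * (‖Q‖ * (S.exists_bound |t|).choose) * |t|) (fun x => by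
      have h1 := (S.exists_bound |t|).choose_spec
      set M := (S.exists_bound |t|).choose
      have hM : 0 ≤ M := zero_le_one.trans h1.1
      have h2 := intervalIntegral.norm_integral_le_of_norm_le_const (a := 0) (b := t)
        (f := fun s => S.opAt (t - s) (Q (S.opAt s x))) (C := M * (‖Q‖ * (M * ‖x‖)))
        (fun s hs => by
          have hs' : s ≤ |t| ∧ t - s ≤ |t| := by
            rcases le_total 0 t with h | h
            · rw [uIoc_of_le h] at hs
              rw [abs_of_nonneg h]
              exact ⟨hs.2, by linarith [hs.1]⟩
            · rw [uIoc_of_ge h] at hs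
              rw [abs_of_nonpos h]
              exact ⟨by linarith [hs.2], by linarith [hs.1]⟩
          exact (S.opAt (t - s)).le_of_opNorm_le_of_le (h1.2 _ hs'.2)
            (Q.le_opNorm_of_le ((S.opAt s).le_of_opNorm_le (h1.2 _ hs'.1) _)))
      rw [sub_zero] at h2
      refine h2.trans (le_of_eq (by ring)))

variable (Q : H →L[ℂ] H)

theorem continuous_dyson_apply (x : H) : Continuous fun t => S.dyson Q t x :=
  S.continuous_conv (Q.continuous.comp (S.continuous_opAt_apply x))

theorem dyson_add {s t : ℝ} (hs : 0 ≤ s) (ht : 0 ≤ t) (x : H) :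
    S.dyson Q (t + s) x = S.opAt t (S.dyson Q s x) + S.dyson Q t (S.opAt s x) := by
  refine (S.conv_add_time (Q.continuous.comp (S.continuous_opAt_apply x)) hs ht).trans ?_
  refine congrArg (S.opAt t (S.dyson Q s x) + ·) ?_
  refine S.conv_congr ht fun r hr _ => ?_
  rw [Function.comp_apply, S.opAt_add_apply hr hs]

theorem tendsto_inv_smul_dyson (x : H) :
    Tendsto (fun h : ℝ => h⁻¹ • S.dyson Q h x) (𝓝[>] 0) (𝓝 (Q x)) := by
  have h1 := S.tendsto_inv_smul_conv (Q.continuous.comp (S.continuous_opAt_apply x))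
  rwa [Function.comp_apply, opAt_zero_apply] at h1

variable {S} in
-- Writing `D` for the Dyson term, the two expansions of `D(t + r)` given by `dyson_add` express
-- `S(r) D(t) x` through `D(r)` and `S(r) x`; dividing by `r` gives the generator. Thus `D(t)`
-- preserves the domain although `Q` need not. Applied to the adjoint semigroup, this is why `V
-- z̃(t)` lies in `D(A*)`.
theorem GenAt.dyson {x y : H} (h : S.GenAt x y) {t : ℝ} (ht : 0 ≤ t) :
    S.GenAt (S.dyson Q t x) (S.dyson Q t y + S.opAt t (Q x) - Q (S.opAt t x)) := by
  have h1 := (((S.dyson Q t).continuous.tendsto y).comp h).add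
    (((S.opAt t).continuous.tendsto (Q x)).comp (S.tendsto_inv_smul_dyson Q x))
  refine (h1.sub (S.tendsto_inv_smul_dyson Q (S.opAt t x))).congr' ?_
  filter_upwards [self_mem_nhdsWithin] with r hr
  have e1 := S.dyson_add Q (le_of_lt hr) ht x
  have e2 := S.dyson_add Q ht (le_of_lt hr) x
  have e3 : S.opAt r (S.dyson Q t x) = S.opAt t (S.dyson Q r x) + S.dyson Q t (S.opAt r x)
      - S.dyson Q r (S.opAt t x) := by
    rw [← e1, add_comm t r, e2, add_sub_cancel_right]
  rw [Function.comp_apply, Function.comp_apply, e3,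
    ContinuousLinearMap.map_smul_of_tower (S.dyson Q t) (r⁻¹ : ℝ),
    ContinuousLinearMap.map_smul_of_tower (S.opAt t) (r⁻¹ : ℝ), ← smul_add, ← smul_sub, map_sub]
  congr 1
  abel

/-- Variation of constants: if `y' = A y + f`, then `y(t) = S(t) y(0) + ∫₀ᵗ S(t - s) f(s) ds`. -/
theorem eq_opAt_add_conv {y f : ℝ → H} {t : ℝ} (ht : 0 ≤ t) (hy : Continuous y)
    (hf : Continuous f)
    (h : ∀ s, 0 ≤ s → s < t →
      Tendsto (fun h : ℝ => h⁻¹ • (y (s + h) - S.opAt h (y s))) (𝓝[>] 0) (𝓝 (f s))) :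
    y t = S.opAt t (y 0) + S.conv f t := by
  -- Differentiate `s ↦ S(t - s) y(s)`: its quotient at `s` is `S(t - s - r)` applied to `r⁻¹ (y(s +
  -- r) - S(r) y(s))`, so joint continuity gives the limit without any assumption that `y(s)` is in
  -- the domain.
  have h1 := sub_eq_integral_of_tendsto_right (y := fun s => S.opAt (t - s) (y s))
    (f := fun s => S.opAt (t - s) (f s)) ht (S.continuous_opAt (by fun_prop) hy)
    (S.continuous_opAt (by fun_prop) hf) (fun s hs hst => by
      have h2 : Tendsto (fun h : ℝ => t - (s + h)) (𝓝[>] 0) (𝓝 (t - s)) := by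
        have : Continuous fun h : ℝ => t - (s + h) := by fun_prop
        simpa using (this.tendsto 0).mono_left nhdsWithin_le_nhds
      have h3 := ((S.continuous_opAt continuous_fst continuous_snd).tendsto (t - s, f s)).comp
        (h2.prodMk_nhds (h s hs hst))
      refine h3.congr' ?_
      filter_upwards [Ioo_mem_nhdsGT (show 0 < t - s by linarith)] with r hr
      simp only [Function.comp_apply]
      rw [ContinuousLinearMap.map_smul_of_tower (S.opAt (t - (s + r))) (r⁻¹ : ℝ), map_sub,
        ← S.opAt_add_apply (by linarith [hr.2]) hr.1.le]
      congr 4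
      ring)
  simp only [sub_self, sub_zero, opAt_zero_apply] at h1
  rw [conv, ← h1]
  abel

variable {S Q} {S' : C0Semigroup H}

/-- Only the relation between the generators is used, so the formula holds for any semigroup
generated by the perturbed operator, not just for the one built by the Neumann series. It holds
because `r⁻¹ (S'(r) - S(r)) y → Q y` along the orbit of `z`. -/
theorem GenAt.eq_opAt_add_conv (hS : ∀ x y, S'.GenAt x (y + Q x) ↔ S.GenAt x y) {z z' : H}
    (hz : S'.GenAt z z') {t : ℝ} (ht : 0 ≤ t) :
    S'.opAt t z = S.opAt t z + S.conv (fun s => Q (S'.opAt s z)) t := by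
  have h1 := S.eq_opAt_add_conv (y := fun s => S'.opAt s z) (f := fun s => Q (S'.opAt s z)) ht
    (S'.continuous_opAt_apply z) (Q.continuous.comp (S'.continuous_opAt_apply z))
    (fun s hs _ => by
      have h2 := hz.map_opAt hs
      have h3 : S.GenAt (S'.opAt s z) (S'.opAt s z' - Q (S'.opAt s z)) :=
        (hS _ _).1 (by rwa [sub_add_cancel])
      have h4 := h2.sub h3
      rw [sub_sub_cancel] at h4
      refine h4.congr' ?_
      filter_upwards [self_mem_nhdsWithin] with r hr
      rw [← smul_sub, add_comm s r, S'.opAt_add_apply (le_of_lt hr) hs]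
      congr 1
      abel)
  rwa [S'.opAt_zero_apply] at h1

/-- Let `y(s) = S(s) z + D(s) z`, with `D` the Dyson term. The generator of `S'` is that of `S` plus
`Q`, so `y` solves the `S'`-equation with source `-Q D(s) z`; variation of constants for `S'` gives
the formula. The remainder involves `S'` and `D` only, and `D` is what the hypothesis on `V`
controls. -/
theorem GenAt.opAt_sub_eq_dyson_add_conv (hS : ∀ x y, S'.GenAt x (y + Q x) ↔ S.GenAt x y)
    {z z' : H} (hz : S.GenAt z z') {t : ℝ} (ht : 0 ≤ t) :
    S'.opAt t z - S.opAt t z = S.dyson Q t z + S'.conv (fun s => Q (S.dyson Q s z)) t := by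
  have h1 := S'.eq_opAt_add_conv (y := fun s => S.opAt s z + S.dyson Q s z)
    (f := fun s => -Q (S.dyson Q s z)) ht
    ((S.continuous_opAt_apply z).add (S.continuous_dyson_apply Q z))
    (Q.continuous.comp (S.continuous_dyson_apply Q z)).neg
    (fun s hs _ => by
      have h2 : S.GenAt (S.opAt s z + S.dyson Q s z)
          (S.opAt s z' + (S.dyson Q s z' + S.opAt s (Q z) - Q (S.opAt s z))) := by
        refine ((hz.map_opAt hs).add (hz.dyson Q hs)).congr fun r => ?_
        rw [← smul_add, map_add]
        congr 1
        abel
      have h3 := (hS _ _).2 h2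
      have h4 := (h2.sub h3).add (S.tendsto_inv_smul_dyson Q (S.opAt s z))
      rw [sub_add_cancel_left, map_add, neg_add_rev, neg_add_cancel_right] at h4
      refine h4.congr' ?_
      filter_upwards [self_mem_nhdsWithin] with r hr
      rw [← smul_sub, ← smul_add]
      congr 1
      rw [add_comm s r, S.opAt_add_apply (le_of_lt hr) hs, S.dyson_add Q hs (le_of_lt hr), map_add,
        map_add]
      abel)
  have h5 : S'.conv (fun s => -Q (S.dyson Q s z)) t = -S'.conv (fun s => Q (S.dyson Q s z)) t := by
    simp only [conv, map_neg]
    exact intervalIntegral.integral_neg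
  have h6 : S.dyson Q 0 z = 0 := S.conv_zero _
  rw [h5, S.opAt_zero_apply, h6, add_zero] at h1
  rw [sub_eq_iff_eq_add, add_right_comm, add_comm (S.dyson Q t z), h1, neg_add_cancel_right]

end C0Semigroup

end Duhamel

/-! ### The output `B* S(t)* z` and the observation inequality -/

section Observation

open scoped ENNReal

variable {H : Type*} [NormedAddCommGroup H] [InnerProductSpace ℂ H] [CompleteSpace H]
variable {U : Type*} [NormedAddCommGroup U] [InnerProductSpace ℂ U] [CompleteSpace U]

theorem AdjointDomain.isInducing (A : H →ₗ.[ℂ] H) :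
    IsInducing (fun z : AdjointDomain A => (AdjointDomain.incl A z, AdjointDomain.op A z)) := by
  have h1 : IsInducing (AdjointDomain.toGraph A) := ⟨rfl⟩
  exact (WithLp.prodContinuousLinearEquiv 2 ℂ H H).toHomeomorph.isInducing.comp h1

theorem AdjointDomain.tendsto_iff (A : H →ₗ.[ℂ] H) {X : Type*} {l : Filter X}
    {f : X → AdjointDomain A} {z : AdjointDomain A} :
    Tendsto f l (𝓝 z) ↔
      Tendsto (fun x => AdjointDomain.incl A (f x)) l (𝓝 (AdjointDomain.incl A z)) ∧
      Tendsto (fun x => AdjointDomain.op A (f x)) l (𝓝 (AdjointDomain.op A z)) := by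
  rw [(AdjointDomain.isInducing A).tendsto_nhds_iff, nhds_prod_eq, tendsto_prod_iff']
  rfl

/-- The operator `B* : D(A*) → U` as a bounded operator for the graph norm. -/
def controlAdjointL {A : H →ₗ.[ℂ] H} (B : U →L[ℂ] AdjointDomainDual A) :
    AdjointDomain A →L[ℂ] U :=
  LinearMap.mkContinuous
    { toFun := controlAdjoint B
      map_add' := fun x y => ext_inner_right ℂ fun v => by
        rw [inner_add_left, inner_controlAdjoint, inner_controlAdjoint, inner_controlAdjoint,
          map_add]
      map_smul' := fun c x => ext_inner_right ℂ fun v => by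
        rw [inner_smul_left, inner_controlAdjoint, inner_controlAdjoint, RingHom.id_apply,
          map_smulₛₗ, smul_eq_mul] } ‖B‖ (fun z => by
      change ‖controlAdjoint B z‖ ≤ _
      rcases (norm_nonneg (controlAdjoint B z)).eq_or_lt with h | h
      · rw [← h]
        positivity
      -- Test `B* z` against itself, then cancel one factor.
      · have h1 : ‖controlAdjoint B z‖ * ‖controlAdjoint B z‖
            ≤ ‖B‖ * ‖z‖ * ‖controlAdjoint B z‖ := by
          rw [← inner_self_eq_norm_mul_norm (𝕜 := ℂ), inner_controlAdjoint]
          refine (RCLike.re_le_norm _).trans (((B _).le_of_opNorm_le (B.le_opNorm _) z).trans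
            (le_of_eq (by ring)))
        exact le_of_mul_le_mul_right h1 h)

theorem controlAdjointL_apply {A : H →ₗ.[ℂ] H} (B : U →L[ℂ] AdjointDomainDual A)
    (z : AdjointDomain A) : controlAdjointL B z = controlAdjoint B z := rfl

namespace C0Semigroup

variable {S : C0Semigroup H} {A : H →ₗ.[ℂ] H} (hA : S.IsGeneratedBy A)

theorem incl_adjointRestrict_eq (t : ℝ) (z : AdjointDomain A) :
    AdjointDomain.incl A (S.adjointRestrict hA t z) = S.adj.opAt t (AdjointDomain.incl A z) :=
  S.incl_adjointRestrict hA t z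

theorem op_adjointRestrict (t : ℝ) (z : AdjointDomain A) :
    AdjointDomain.op A (S.adjointRestrict hA t z) = S.adj.opAt t (AdjointDomain.op A z) :=
  (S.adjoint_mem hA t z).choose_spec.2

theorem continuous_adjointRestrict (z : AdjointDomain A) :
    Continuous fun t => S.adjointRestrict hA t z := by
  rw [AdjointDomain.continuous_iff]
  simp only [incl_adjointRestrict_eq, op_adjointRestrict]
  exact ⟨S.adj.continuous_opAt_apply _, S.adj.continuous_opAt_apply _⟩

theorem adjointRestrict_add {s t : ℝ} (hs : 0 ≤ s) (ht : 0 ≤ t) (z : AdjointDomain A) :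
    S.adjointRestrict hA (s + t) z = S.adjointRestrict hA s (S.adjointRestrict hA t z) := by
  apply AdjointDomain.incl_injective A
  simp only [incl_adjointRestrict_eq]
  exact S.adj.opAt_add_apply hs ht _

/-- The operator `x ↦ ∫₀ʰ S(t)* x dt`, with values in `D(A*)`. -/
def smoothing {h : ℝ} (hh : 0 ≤ h) : H →L[ℂ] AdjointDomain A where
  toFun x := (hA.exists_of_adj_genAt (S.adj.genAt_integ hh x)).choose
  map_add' x y := by
    apply AdjointDomain.incl_injective A
    have hs := fun x => (hA.exists_of_adj_genAt (S.adj.genAt_integ hh x)).choose_spec.1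
    refine (hs _).trans ?_
    rw [map_add, map_add, hs, hs]
  map_smul' c x := by
    apply AdjointDomain.incl_injective A
    have hs := fun x => (hA.exists_of_adj_genAt (S.adj.genAt_integ hh x)).choose_spec.1
    refine (hs _).trans ?_
    rw [map_smul, map_smul, hs, RingHom.id_apply]
  cont := by
    have hs := fun x => (hA.exists_of_adj_genAt (S.adj.genAt_integ hh x)).choose_spec
    rw [AdjointDomain.continuous_iff]
    exact ⟨(S.adj.integ h).continuous.congr fun x => (hs x).1.symm,
      ((S.adj.opAt h).continuous.sub continuous_id).congr fun x => (hs x).2.symm⟩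

theorem incl_smoothing {h : ℝ} (hh : 0 ≤ h) (x : H) :
    AdjointDomain.incl A (smoothing hA hh x) = S.adj.integ h x :=
  (hA.exists_of_adj_genAt (S.adj.genAt_integ hh x)).choose_spec.1

theorem op_smoothing {h : ℝ} (hh : 0 ≤ h) (x : H) :
    AdjointDomain.op A (smoothing hA hh x) = S.adj.opAt h x - x :=
  (hA.exists_of_adj_genAt (S.adj.genAt_integ hh x)).choose_spec.2

theorem smoothing_opAt {h : ℝ} (hh : 0 ≤ h) {t : ℝ} (ht : 0 ≤ t) (x : H) :
    smoothing hA hh (S.adj.opAt t x) = S.adjointRestrict hA t (smoothing hA hh x) := by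
  apply AdjointDomain.incl_injective A
  rw [incl_adjointRestrict_eq, incl_smoothing, incl_smoothing, S.adj.opAt_integ ht hh]

/-- In the graph norm there are two limits to check: the averages tend to `z`, and `A*` of the
average is the difference quotient `h⁻¹ (S(h)* z - z)`, which tends to `A* z`. -/
theorem tendsto_smoothing {h : ℕ → ℝ} (hh : ∀ n, 0 < h n) (hlim : Tendsto h atTop (𝓝 0))
    (z : AdjointDomain A) :
    Tendsto (fun n => ((h n)⁻¹ : ℂ) • smoothing hA (hh n).le (AdjointDomain.incl A z)) atTop
      (𝓝 z) := by
  have hlim' : Tendsto h atTop (𝓝[>] 0) :=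
    tendsto_nhdsWithin_iff.2 ⟨hlim, Eventually.of_forall hh⟩
  rw [AdjointDomain.tendsto_iff]
  refine ⟨((S.adj.tendsto_inv_smul_integ _).comp hlim').congr fun n => ?_,
    ((hA.adj_genAt z).comp hlim').congr fun n => ?_⟩
  · rw [map_smul, incl_smoothing, ← Complex.ofReal_inv, Complex.coe_smul]
    rfl
  · rw [map_smul, op_smoothing, ← Complex.ofReal_inv, Complex.coe_smul]
    rfl

variable (B : U →L[ℂ] AdjointDomainDual A)

/-- The energy `∫₀ᵀ ‖B* S(t)* z‖² dt` of the output. -/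
def energy (T : ℝ) (z : AdjointDomain A) : ℝ≥0∞ :=
  ∫⁻ t in Ioc 0 T, ‖controlAdjointL B (S.adjointRestrict hA t z)‖ₑ ^ 2

/-- Inequality of observation: the energy up to time `T` is bounded by the norm of `H`. -/
def ObsBound (T : ℝ) : Prop :=
  ∃ M : ℝ≥0, ∀ z : AdjointDomain A, energy hA B T z ≤ M * ‖AdjointDomain.incl A z‖ₑ ^ 2

theorem continuous_output (z : AdjointDomain A) :
    Continuous fun t => controlAdjointL B (S.adjointRestrict hA t z) :=
  (controlAdjointL B).continuous.comp (continuous_adjointRestrict hA z)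

end C0Semigroup

theorem lintegral_Ioc_zero_add (f : ℝ → ℝ≥0∞) {a b : ℝ} (ha : 0 ≤ a) (hb : 0 ≤ b) :
    ∫⁻ t in Ioc 0 (b + a), f t = (∫⁻ t in Ioc 0 a, f t) + ∫⁻ t in Ioc 0 b, f (t + a) := by
  rw [← Ioc_union_Ioc_eq_Ioc ha (by linarith : a ≤ b + a), lintegral_union measurableSet_Ioc
    (Ioc_disjoint_Ioc_of_le le_rfl)]
  congr 1
  rw [← lintegral_indicator measurableSet_Ioc, ← lintegral_indicator measurableSet_Ioc,
    ← lintegral_add_right_eq_self _ a]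
  refine lintegral_congr fun t => ?_
  simp only [indicator, mem_Ioc, add_le_add_iff_right, lt_add_iff_pos_left]

theorem lintegral_Ioc_reflect (f : ℝ → ℝ≥0∞) (T : ℝ) :
    ∫⁻ t in Ioc 0 T, f (T - t) = ∫⁻ t in Ioc 0 T, f t := by
  -- Reflection exchanges the open and the closed endpoint, hence the passage to the closed
  -- interval.
  rw [Measure.restrict_congr_set Ioc_ae_eq_Icc, ← lintegral_indicator measurableSet_Icc,
    ← lintegral_indicator measurableSet_Icc, ← lintegral_sub_left_eq_self _ T]
  refine lintegral_congr fun t => ?_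
  simp only [indicator, mem_Icc, sub_nonneg, sub_le_self_iff, and_comm, sub_sub_cancel]

namespace C0Semigroup

variable {S : C0Semigroup H} {A : H →ₗ.[ℂ] H} {hA : S.IsGeneratedBy A}
  {B : U →L[ℂ] AdjointDomainDual A}

theorem energy_add {a b : ℝ} (ha : 0 ≤ a) (hb : 0 ≤ b) (z : AdjointDomain A) :
    energy hA B (b + a) z = energy hA B a z + energy hA B b (S.adjointRestrict hA a z) := by
  rw [energy, lintegral_Ioc_zero_add _ ha hb, energy, energy]
  congr 1
  refine setLIntegral_congr_fun measurableSet_Ioc fun t ht => ?_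
  rw [adjointRestrict_add hA ht.1.le ha]

theorem energy_mono {a b : ℝ} (h : a ≤ b) (z : AdjointDomain A) :
    energy hA B a z ≤ energy hA B b z :=
  lintegral_mono_set (Ioc_subset_Ioc_right h)

theorem enorm_opAt_le (S : C0Semigroup H) {M : ℝ} {t : ℝ} (h : ‖S.opAt t‖ ≤ M) (x : H) :
    ‖S.opAt t x‖ₑ ≤ ENNReal.ofReal M * ‖x‖ₑ := by
  rw [← ofReal_norm, ← ofReal_norm, ← ENNReal.ofReal_mul ((norm_nonneg _).trans h)]
  exact ENNReal.ofReal_le_ofReal ((S.opAt t).le_of_opNorm_le h x)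

theorem ObsBound.mono {a b : ℝ} (hab : a ≤ b) (h : ObsBound hA B b) : ObsBound hA B a := by
  obtain ⟨M, hM⟩ := h
  exact ⟨M, fun z => (energy_mono hab z).trans (hM z)⟩

/-- Cover `(0, T']` by blocks of length `T`; each further block is an output restarted from `S(T)*
z`, whose norm is at most a constant times that of `z`. -/
theorem ObsBound.all {T : ℝ} (hT : 0 < T) (h : ObsBound hA B T) (T' : ℝ) :
    ObsBound hA B T' := by
  have hind : ∀ n : ℕ, ObsBound hA B (n * T) := by
    intro n
    induction n with
    | zero => exact ⟨0, fun z => by simp [energy]⟩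
    | succ n ih =>
      obtain ⟨M, hM⟩ := h
      obtain ⟨N, hN⟩ := ih
      obtain ⟨K, -, hK⟩ := S.adj.exists_bound T
      refine ⟨M + N * K.toNNReal ^ 2, fun z => ?_⟩
      have e : ((n + 1 : ℕ) : ℝ) * T = n * T + T := by
        push_cast
        ring
      rw [e, energy_add hT.le (by positivity)]
      refine (add_le_add (hM z) (hN _)).trans ?_
      rw [incl_adjointRestrict_eq]
      push_cast
      rw [add_mul, mul_assoc, ← mul_pow]
      gcongr
      exact S.adj.enorm_opAt_le (hK T le_rfl) _
  obtain ⟨n, hn⟩ := exists_nat_ge (T' / T)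
  rw [div_le_iff₀ hT] at hn
  exact (hind n).mono hn

end C0Semigroup

theorem sq_lintegral_le {X : Type*} [MeasurableSpace X] {μ : Measure X} {f : X → ℝ≥0∞}
    (hf : AEMeasurable f μ) : (∫⁻ x, f x ∂μ) ^ 2 ≤ μ univ * ∫⁻ x, f x ^ 2 ∂μ := by
  have h1 := ENNReal.lintegral_mul_le_Lp_mul_Lq μ Real.HolderConjugate.two_two hf
    (aemeasurable_const (b := (1 : ℝ≥0∞)))
  simp only [Pi.mul_apply, mul_one, ENNReal.one_rpow, lintegral_const, one_mul] at h1
  calc (∫⁻ x, f x ∂μ) ^ 2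
      ≤ ((∫⁻ a, f a ^ (2 : ℝ) ∂μ) ^ (1 / 2 : ℝ) * μ univ ^ (1 / 2 : ℝ)) ^ 2 := by gcongr
    _ = μ univ * ∫⁻ x, f x ^ 2 ∂μ := by
      rw [mul_pow, ← ENNReal.rpow_natCast, ← ENNReal.rpow_natCast, ← ENNReal.rpow_mul,
        ← ENNReal.rpow_mul]
      norm_num [mul_comm]

end Observation

/-! ### Duality between admissibility and observation; convolution estimate -/

section InputMap

open scoped ENNReal

variable {H : Type*} [NormedAddCommGroup H] [InnerProductSpace ℂ H] [CompleteSpace H]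
variable {U : Type*} [NormedAddCommGroup U] [InnerProductSpace ℂ U] [CompleteSpace U]

namespace C0Semigroup

variable {S : C0Semigroup H} {A : H →ₗ.[ℂ] H} (hA : S.IsGeneratedBy A)
  (B : U →L[ℂ] AdjointDomainDual A)

theorem memLp_output (T : ℝ) (z : AdjointDomain A) :
    MemLp ((Ioc 0 T).indicator fun s => controlAdjointL B (S.adjointRestrict hA (T - s) z)) 2
      (volume.restrict (Ioi (0 : ℝ))) := by
  have hc : Continuous fun s => controlAdjointL B (S.adjointRestrict hA (T - s) z) :=
    (continuous_output hA B z).comp (by fun_prop : Continuous fun s => T - s)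
  rw [memLp_indicator_iff_restrict measurableSet_Ioc, Measure.restrict_restrict measurableSet_Ioc,
    inter_eq_self_of_subset_left Ioc_subset_Ioi_self]
  obtain ⟨c, hcb⟩ := (isCompact_Icc (a := 0) (b := T)).exists_bound_of_continuousOn hc.continuousOn
  refine MemLp.of_bound hc.aestronglyMeasurable c ?_
  filter_upwards [ae_restrict_mem measurableSet_Ioc] with s hs
  exact hcb s (Ioc_subset_Icc_self hs)

/-- The output `s ↦ 1_{(0,T)}(s) B* S(T - s)* z`, as an element of `L²(0, +∞; U)`. -/
def outputLp (T : ℝ) : AdjointDomain A →ₗ[ℂ] ControlSpace U where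
  toFun z := (memLp_output hA B T z).toLp _
  map_add' x y := by
    rw [← MemLp.toLp_add]
    congr 1
    simp only [map_add]
    exact indicator_add _ _ _
  map_smul' c x := by
    rw [RingHom.id_apply, ← MemLp.toLp_const_smul]
    congr 1
    simp only [map_smul]
    exact indicator_const_smul _ _ _

theorem coeFn_outputLp (T : ℝ) (z : AdjointDomain A) :
    outputLp hA B T z =ᵐ[volume.restrict (Ioi (0 : ℝ))]
      (Ioc 0 T).indicator fun s => controlAdjointL B (S.adjointRestrict hA (T - s) z) :=
  MemLp.coeFn_toLp (memLp_output hA B T z)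

end C0Semigroup

theorem enorm_Lp_two_sq {X : Type*} [MeasurableSpace X] {μ : Measure X} {E : Type*}
    [NormedAddCommGroup E] (f : Lp E 2 μ) : ‖f‖ₑ ^ 2 = ∫⁻ x, ‖f x‖ₑ ^ 2 ∂μ := by
  rw [Lp.enorm_def, eLpNorm_eq_lintegral_rpow_enorm_toReal (by norm_num) (by norm_num),
    ← ENNReal.rpow_natCast, ← ENNReal.rpow_mul]
  norm_num

theorem setLIntegral_indicator_enorm_sq {E : Type*} [NormedAddCommGroup E] (T : ℝ) (f : ℝ → E) :
    ∫⁻ s in Ioi (0 : ℝ), ‖(Ioc 0 T).indicator f s‖ₑ ^ 2 = ∫⁻ s in Ioc 0 T, ‖f s‖ₑ ^ 2 := by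
  have e : ∀ s, ‖(Ioc 0 T).indicator f s‖ₑ ^ 2
      = (Ioc 0 T).indicator (fun s => ‖f s‖ₑ ^ 2) s := by
    intro s
    by_cases hs : s ∈ Ioc 0 T <;> simp [hs]
  simp only [e]
  rw [lintegral_indicator measurableSet_Ioc, Measure.restrict_restrict measurableSet_Ioc,
    inter_eq_self_of_subset_left Ioc_subset_Ioi_self]

namespace C0Semigroup

variable {S : C0Semigroup H} {A : H →ₗ.[ℂ] H} (hA : S.IsGeneratedBy A)
  (B : U →L[ℂ] AdjointDomainDual A)

theorem enorm_outputLp_sq (T : ℝ) (z : AdjointDomain A) :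
    ‖outputLp hA B T z‖ₑ ^ 2 = energy hA B T z := by
  rw [enorm_Lp_two_sq, energy, ← lintegral_Ioc_reflect, ← setLIntegral_indicator_enorm_sq]
  refine lintegral_congr_ae ?_
  filter_upwards [coeFn_outputLp hA B T z] with s hs
  rw [hs]

/-- The duality on which everything rests: the formal adjoint of the input map is the time-reversed
output. -/
theorem inner_outputLp {T : ℝ} (hT : 0 ≤ T) (u : ControlSpace U) (z : AdjointDomain A) :
    ⟪outputLp hA B T z, u⟫_ℂ = inputFunctional S hA B T u z := by
  rw [L2.inner_def, inputFunctional, intervalIntegral.integral_of_le hT]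
  have e : ∀ᵐ s ∂(volume.restrict (Ioi (0 : ℝ))), ⟪outputLp hA B T z s, u s⟫_ℂ
      = (Ioc 0 T).indicator (fun s => S.extension hA (T - s) (B (u s)) z) s := by
    filter_upwards [coeFn_outputLp hA B T z] with s hs
    rw [hs]
    by_cases h : s ∈ Ioc 0 T
    · rw [indicator_of_mem h, indicator_of_mem h, controlAdjointL_apply, inner_controlAdjoint]
      rfl
    · rw [indicator_of_notMem h, indicator_of_notMem h, inner_zero_left]
  rw [integral_congr_ae e, integral_indicator measurableSet_Ioc,
    Measure.restrict_restrict measurableSet_Ioc,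
    inter_eq_self_of_subset_left Ioc_subset_Ioi_self]

variable {hA B}

theorem ObsBound.exists_norm_le {T : ℝ} (h : ObsBound hA B T) :
    ∃ C : ℝ, ∀ z, ‖outputLp hA B T z‖ ≤ C * ‖AdjointDomain.incl A z‖ := by
  obtain ⟨M, hM⟩ := h
  refine ⟨Real.sqrt M, fun z => ?_⟩
  have h1 := hM z
  rw [← enorm_outputLp_sq, enorm_eq_nnnorm, enorm_eq_nnnorm] at h1
  have h2 : ‖outputLp hA B T z‖ ^ 2 ≤ M * ‖AdjointDomain.incl A z‖ ^ 2 := by exact_mod_cast h1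
  refine le_of_sq_le_sq ?_ (by positivity)
  rw [mul_pow, Real.sq_sqrt M.coe_nonneg]
  exact h2

theorem obsBound_of_norm_le {T C : ℝ}
    (h : ∀ z, ‖outputLp hA B T z‖ ≤ C * ‖AdjointDomain.incl A z‖) : ObsBound hA B T := by
  refine ⟨C.toNNReal ^ 2, fun z => ?_⟩
  rw [← enorm_outputLp_sq, ENNReal.coe_pow, ← mul_pow]
  gcongr
  rw [enorm_eq_nnnorm, enorm_eq_nnnorm]
  have h1 : ‖outputLp hA B T z‖ ≤ C.toNNReal * ‖AdjointDomain.incl A z‖ :=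
    (h z).trans (by gcongr; exact Real.le_coe_toNNReal C)
  exact_mod_cast h1

/-- Uniform boundedness for the functionals `⟪output of z, ·⟫` with `‖z‖_H ≤ 1`: at each `u` they
are bounded by the norm of the vector of `H` that admissibility provides. Scaling removes the
restriction on `z`. -/
theorem exists_obsBound (h : IsAdmissible S hA B) : ∃ T, 0 < T ∧ ObsBound hA B T := by
  obtain ⟨T, hT, h⟩ := h
  refine ⟨T, hT, ?_⟩
  choose x hx using h
  obtain ⟨C, hC⟩ := banach_steinhaus
    (g := fun z : {z : AdjointDomain A // ‖AdjointDomain.incl A z‖ ≤ 1} =>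
      innerSL ℂ (outputLp hA B T z)) (fun u => ⟨‖x u‖, fun z => by
        rw [innerSL_apply_apply, inner_outputLp hA B hT.le, ← hx]
        refine (norm_inner_le_norm _ _).trans ?_
        nlinarith [z.2, norm_nonneg (x u)]⟩)
  refine obsBound_of_norm_le (C := C) fun z => ?_
  rcases eq_or_ne z 0 with rfl | hz
  · simp
  · have h1 : AdjointDomain.incl A z ≠ 0 := fun h =>
      hz (AdjointDomain.incl_injective A (by rw [h, map_zero]))
    have h2 : 0 < ‖AdjointDomain.incl A z‖ := norm_pos_iff.2 h1
    have h3 := hC ⟨((‖AdjointDomain.incl A z‖ : ℂ)⁻¹) • z, by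
      rw [map_smul, norm_smul, norm_inv, Complex.norm_real, norm_norm, inv_mul_cancel₀ h2.ne']⟩
    rw [innerSL_apply_norm, map_smul, norm_smul, norm_inv, Complex.norm_real, norm_norm,
      inv_mul_le_iff₀ h2] at h3
    linarith

/-- The output map is bounded for the norm of `H` on the dense subspace `D(A*)`, so it extends to
`H`; the adjoint of the extension is the input map. -/
theorem ObsBound.exists_inputMap {T : ℝ} (hT : 0 ≤ T) (h : ObsBound hA B T) :
    ∃ Φ : ControlSpace U →L[ℂ] H, IsInputMap S hA B T Φ := by
  refine ⟨ContinuousLinearMap.adjoint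
    ((outputLp hA B T).extendOfNorm (AdjointDomain.incl A)), fun u z => ?_⟩
  rw [ContinuousLinearMap.adjoint_inner_right,
    LinearMap.extendOfNorm_eq hA.denseRange_incl h.exists_norm_le, inner_outputLp hA B hT]

theorem _root_.IsInputMap.adjoint_apply {T : ℝ} (hT : 0 ≤ T) {Φ : ControlSpace U →L[ℂ] H}
    (h : IsInputMap S hA B T Φ) (z : AdjointDomain A) :
    ContinuousLinearMap.adjoint Φ (AdjointDomain.incl A z) = outputLp hA B T z := by
  refine ext_inner_right ℂ fun u => ?_
  rw [ContinuousLinearMap.adjoint_inner_left, h u z, inner_outputLp hA B hT]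

end C0Semigroup

/-- Young's inequality for a convolution-type integral with a continuous kernel. -/
theorem lintegral_sq_enorm_conv_le {E : Type*} [NormedAddCommGroup E] [NormedSpace ℝ E]
    {φ : ℝ × ℝ → E} (hφ : Continuous φ) (T : ℝ) :
    ∫⁻ t in Ioc 0 T, ‖∫ s in Ioc 0 t, φ (t - s, s)‖ₑ ^ 2
      ≤ ENNReal.ofReal T * ∫⁻ s in Ioc 0 T, ∫⁻ a in Ioc 0 T, ‖φ (a, s)‖ₑ ^ 2 := by
  -- With this cutoff, Cauchy–Schwarz in `s` leaves an integral that can be extended to all `t ∈ ℝ`,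
  -- where Tonelli and the translation `t ↦ t - s` apply.
  let g : ℝ → ℝ → ℝ≥0∞ := fun a s => (Icc 0 T).indicator (fun a => ‖φ (a, s)‖ₑ ^ 2) a
  have hg : Measurable (Function.uncurry g) := by
    have h1 : Function.uncurry g = (Icc 0 T ×ˢ univ).indicator fun p : ℝ × ℝ => ‖φ p‖ₑ ^ 2 := by
      ext ⟨a, s⟩
      simp only [Function.uncurry_apply_pair, g, indicator, mem_prod, mem_univ, and_true]
    rw [h1]
    exact (hφ.enorm.measurable.pow_const 2).indicator (measurableSet_Icc.prod MeasurableSet.univ)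
  have h1 : ∀ t ∈ Ioc 0 T, ‖∫ s in Ioc 0 t, φ (t - s, s)‖ₑ ^ 2
      ≤ ENNReal.ofReal T * ∫⁻ s in Ioc 0 T, g (t - s) s := by
    intro t ht
    have hm : Continuous fun s => φ (t - s, s) := hφ.comp (by fun_prop)
    calc ‖∫ s in Ioc 0 t, φ (t - s, s)‖ₑ ^ 2
        ≤ (∫⁻ s in Ioc 0 t, ‖φ (t - s, s)‖ₑ) ^ 2 := by
          gcongr
          exact enorm_integral_le_lintegral_enorm _
      _ ≤ volume.restrict (Ioc 0 t) univ * ∫⁻ s in Ioc 0 t, ‖φ (t - s, s)‖ₑ ^ 2 :=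
          sq_lintegral_le hm.enorm.measurable.aemeasurable
      _ = ENNReal.ofReal t * ∫⁻ s in Ioc 0 t, g (t - s) s := by
          rw [Measure.restrict_apply_univ, Real.volume_Ioc, sub_zero]
          congr 1
          refine setLIntegral_congr_fun measurableSet_Ioc fun s hs => ?_
          have h2 : t - s ∈ Icc 0 T := ⟨by linarith [hs.2], by linarith [hs.1, ht.2]⟩
          simp only [g, indicator_of_mem h2]
      _ ≤ ENNReal.ofReal T * ∫⁻ s in Ioc 0 T, g (t - s) s := by
          gcongr
          · exact ht.2
          · exact ht.2
  calc ∫⁻ t in Ioc 0 T, ‖∫ s in Ioc 0 t, φ (t - s, s)‖ₑ ^ 2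
      ≤ ∫⁻ t in Ioc 0 T, ENNReal.ofReal T * ∫⁻ s in Ioc 0 T, g (t - s) s :=
        setLIntegral_mono' measurableSet_Ioc h1
    _ ≤ ∫⁻ t, ENNReal.ofReal T * ∫⁻ s in Ioc 0 T, g (t - s) s := setLIntegral_le_lintegral _ _
    _ = ENNReal.ofReal T * ∫⁻ s in Ioc 0 T, ∫⁻ t, g (t - s) s := by
        rw [lintegral_const_mul' _ _ ENNReal.ofReal_ne_top, lintegral_lintegral_swap]
        exact (hg.comp (by fun_prop : Measurable fun p : ℝ × ℝ => (p.1 - p.2, p.2))).aemeasurable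
    _ = _ := by
        congr 1
        refine lintegral_congr fun s => ?_
        rw [lintegral_sub_right_eq_self (fun a => g a s) s]
        simp only [g]
        rw [lintegral_indicator measurableSet_Icc, ← Measure.restrict_congr_set Ioc_ae_eq_Icc]

namespace C0Semigroup

variable {S : C0Semigroup H} {A : H →ₗ.[ℂ] H} {hA : S.IsGeneratedBy A}
  {B : U →L[ℂ] AdjointDomainDual A}

/-- Convolutions with `S(·)*` that take their values in `D(A*)` have a square integrable image
under `B*`. -/
theorem ObsBound.exists_conv_bound {T : ℝ} (h : ObsBound hA B T) :
    ∃ K : ℝ≥0, ∀ (f : ℝ → H) (w : ℝ → AdjointDomain A), Continuous f →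
      (∀ t ∈ Ioc 0 T, AdjointDomain.incl A (w t) = S.adj.conv f t) →
      ∫⁻ t in Ioc 0 T, ‖controlAdjointL B (w t)‖ₑ ^ 2 ≤ K * ∫⁻ t in Ioc 0 T, ‖f t‖ₑ ^ 2 := by
  obtain ⟨N, hN⟩ := h
  obtain ⟨M, hM1, hM⟩ := S.adj.exists_bound 1
  have hM0 : 0 ≤ M := zero_le_one.trans hM1
  refine ⟨T.toNNReal * (N * M.toNNReal ^ 2), fun f w hf hw => ?_⟩
  set r : ℕ → ℝ := fun n => 1 / ((n : ℝ) + 1)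
  have hr0 : ∀ n, 0 < r n := fun n => by positivity
  have hr1 : ∀ n, r n ≤ 1 := fun n => by
    rw [div_le_one (by positivity)]
    linarith [n.cast_nonneg (α := ℝ)]
  have hrlim : Tendsto r atTop (𝓝 0) := tendsto_one_div_add_atTop_nhds_zero_nat
  -- `B*` is not bounded on `H`, but `B* Rₙ` is, where `Rₙ` averages `S(·)*` over `(0, r n)`. The
  -- `Rₙ` commute with `S(t)*` and are uniformly bounded on `H`, so the estimate below does not
  -- depend on `n`.
  let R : ℕ → H →L[ℂ] AdjointDomain A := fun n => ((r n)⁻¹ : ℂ) • smoothing hA (hr0 n).le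
  have hRincl : ∀ n x, ‖AdjointDomain.incl A (R n x)‖ₑ ≤ M.toNNReal * ‖x‖ₑ := by
    intro n x
    have h1 : ‖AdjointDomain.incl A (R n x)‖ ≤ M.toNNReal * ‖x‖ := by
      have h2 := (S.adj.integ (r n)).le_of_opNorm_le
        (S.adj.norm_integ_le hM (hr0 n).le (hr1 n)) x
      change ‖AdjointDomain.incl A (((r n)⁻¹ : ℂ) • smoothing hA (hr0 n).le x)‖ ≤ _
      rw [map_smul, incl_smoothing, norm_smul, norm_inv, Complex.norm_real,
        Real.norm_of_nonneg (hr0 n).le, inv_mul_le_iff₀ (hr0 n), Real.coe_toNNReal M hM0]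
      linarith
    rw [enorm_eq_nnnorm, enorm_eq_nnnorm]
    exact_mod_cast h1
  have hRcomm : ∀ n t, 0 ≤ t → ∀ x,
      R n (S.adj.opAt t x) = S.adjointRestrict hA t (R n x) := by
    intro n t ht x
    change ((r n)⁻¹ : ℂ) • smoothing hA (hr0 n).le (S.adj.opAt t x)
      = S.adjointRestrict hA t (((r n)⁻¹ : ℂ) • smoothing hA (hr0 n).le x)
    rw [smoothing_opAt hA _ ht, map_smul]
  have hRlim : ∀ z, Tendsto (fun n => R n (AdjointDomain.incl A z)) atTop (𝓝 z) :=
    fun z => tendsto_smoothing hA hr0 hrlim z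
  have hcontF : Continuous (S.adj.conv f) := S.adj.continuous_conv hf
  have key : ∀ n, ∫⁻ t in Ioc 0 T, ‖controlAdjointL B (R n (S.adj.conv f t))‖ₑ ^ 2
      ≤ (T.toNNReal * (N * M.toNNReal ^ 2) : ℝ≥0) * ∫⁻ t in Ioc 0 T, ‖f t‖ₑ ^ 2 := by
    intro n
    let L : H →L[ℂ] U := (controlAdjointL B).comp (R n)
    have hLc : Continuous fun p : ℝ × ℝ => L (S.adj.opAt p.1 (f p.2)) :=
      L.continuous.comp (S.adj.continuous_opAt continuous_fst (hf.comp continuous_snd))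
    have e1 : ∀ t ∈ Ioc 0 T, ‖controlAdjointL B (R n (S.adj.conv f t))‖ₑ ^ 2
        = ‖∫ s in Ioc 0 t, L (S.adj.opAt (t - s) (f s))‖ₑ ^ 2 := by
      intro t ht
      rw [← intervalIntegral.integral_of_le ht.1.le]
      congr 2
      exact (L.intervalIntegral_comp_comm (S.adj.intervalIntegrable_conv hf t 0 t)).symm
    rw [setLIntegral_congr_fun measurableSet_Ioc e1]
    refine (lintegral_sq_enorm_conv_le hLc T).trans ?_
    have h1 : ∀ s, ∫⁻ a in Ioc 0 T, ‖L (S.adj.opAt a (f s))‖ₑ ^ 2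
        ≤ (N * M.toNNReal ^ 2 : ℝ≥0) * ‖f s‖ₑ ^ 2 := by
      intro s
      have h3 : ∫⁻ a in Ioc 0 T, ‖L (S.adj.opAt a (f s))‖ₑ ^ 2 = energy hA B T (R n (f s)) := by
        refine setLIntegral_congr_fun measurableSet_Ioc fun a ha => ?_
        simp only [L, ContinuousLinearMap.comp_apply]
        rw [hRcomm n a ha.1.le]
      rw [h3]
      refine (hN _).trans ?_
      rw [ENNReal.coe_mul, mul_assoc, ENNReal.coe_pow, ← mul_pow]
      gcongr
      exact hRincl n _
    calc ENNReal.ofReal T * ∫⁻ s in Ioc 0 T, ∫⁻ a in Ioc 0 T, ‖L (S.adj.opAt a (f s))‖ₑ ^ 2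
        ≤ ENNReal.ofReal T * ∫⁻ s in Ioc 0 T, (N * M.toNNReal ^ 2 : ℝ≥0) * ‖f s‖ₑ ^ 2 := by
          gcongr with s
          exact h1 s
      _ = (T.toNNReal * (N * M.toNNReal ^ 2) : ℝ≥0) * ∫⁻ t in Ioc 0 T, ‖f t‖ₑ ^ 2 := by
          rw [lintegral_const_mul' _ _ ENNReal.coe_ne_top, ENNReal.coe_mul T.toNNReal, mul_assoc]
          rfl
  have hlim : ∀ t ∈ Ioc 0 T,
      Tendsto (fun n => ‖controlAdjointL B (R n (S.adj.conv f t))‖ₑ ^ 2) atTop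
        (𝓝 (‖controlAdjointL B (w t)‖ₑ ^ 2)) := by
    intro t ht
    rw [← hw t ht]
    exact (((ENNReal.continuous_pow 2).comp (controlAdjointL B).continuous.enorm).tendsto (w t)).comp
      (hRlim (w t))
  -- Fatou's lemma removes the regularization, since `Rₙ w(t) → w(t)` in the graph norm.
  calc ∫⁻ t in Ioc 0 T, ‖controlAdjointL B (w t)‖ₑ ^ 2
      = ∫⁻ t in Ioc 0 T, liminf
          (fun n => ‖controlAdjointL B (R n (S.adj.conv f t))‖ₑ ^ 2) atTop :=
        setLIntegral_congr_fun measurableSet_Ioc fun t ht => (hlim t ht).liminf_eq.symm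
    _ ≤ liminf (fun n => ∫⁻ t in Ioc 0 T,
          ‖controlAdjointL B (R n (S.adj.conv f t))‖ₑ ^ 2) atTop :=
        lintegral_liminf_le fun n =>
          (((controlAdjointL B).comp (R n)).continuous.comp hcontF).enorm.measurable.pow_const 2
    _ ≤ _ := liminf_le_of_le (by isBoundedDefault) fun b hb => by
        obtain ⟨n, hn⟩ := hb.exists
        exact hn.trans (key n)

end C0Semigroup

end InputMap

/-! ### Compactness through domination by compact quadratic forms -/

section Compactness

open scoped ENNReal

variable {H : Type*} [NormedAddCommGroup H] [InnerProductSpace ℂ H]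
variable {D : Type*} {ι : D → H}

/-- For `x`, `y` in the unit ball, `‖L (x - y)‖² ≤ 2 ‖R (x - y)‖`. So points whose images form an
`ε²/2`-net for `R` give an `ε`-net for `L`. -/
theorem isCompactOperator_of_sq_norm_le {X : Type*} [NormedAddCommGroup X] [NormedSpace ℂ X]
    [CompleteSpace X] (L : H →L[ℂ] X) (R : H →L[ℂ] H) (hR : IsCompactOperator R)
    (h : ∀ x, ‖L x‖ ^ 2 ≤ RCLike.re ⟪R x, x⟫_ℂ) : IsCompactOperator L := by
  have htb : TotallyBounded (R '' Metric.closedBall 0 1) :=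
    ((isCompactOperator_iff_isCompact_closure_image_closedBall (R : H →ₗ[ℂ] H) zero_lt_one).1
      hR).totallyBounded.subset subset_closure
  refine (isCompactOperator_iff_isCompact_closure_image_closedBall (L : H →ₗ[ℂ] X)
    zero_lt_one).2 ((TotallyBounded.closure ?_).isCompact_of_isClosed isClosed_closure)
  rw [Metric.totallyBounded_iff]
  intro ε hε
  obtain ⟨t, hts, htf, htc⟩ := Metric.finite_approx_of_totallyBounded htb (ε ^ 2 / 2)
    (by positivity)
  have hp : ∀ y, ∃ x, y ∈ t → x ∈ Metric.closedBall (0 : H) 1 ∧ R x = y := by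
    intro y
    by_cases hy : y ∈ t
    · obtain ⟨x, hx⟩ := hts hy
      exact ⟨x, fun _ => hx⟩
    · exact ⟨0, fun h => absurd h hy⟩
  choose p hp using hp
  refine ⟨(fun y => L (p y)) '' t, htf.image _, ?_⟩
  rintro _ ⟨x, hx, rfl⟩
  obtain ⟨y, hy, hxy⟩ := mem_iUnion₂.1 (htc ⟨x, hx, rfl⟩)
  refine mem_iUnion₂.2 ⟨_, ⟨y, hy, rfl⟩, ?_⟩
  obtain ⟨hp1, hp2⟩ := hp y hy
  rw [Metric.mem_ball, dist_eq_norm] at hxy ⊢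
  rw [mem_closedBall_zero_iff] at hx hp1
  rw [← hp2, ← map_sub] at hxy
  change ‖L x - L (p y)‖ < ε
  rw [← map_sub]
  have h1 : ‖L (x - p y)‖ ^ 2 < ε ^ 2 := by
    calc ‖L (x - p y)‖ ^ 2 ≤ RCLike.re ⟪R (x - p y), x - p y⟫_ℂ := h _
      _ ≤ ‖R (x - p y)‖ * ‖x - p y‖ := (RCLike.re_le_norm _).trans (norm_inner_le_norm _ _)
      _ ≤ ‖R (x - p y)‖ * 2 := by
        gcongr
        exact (norm_sub_le _ _).trans (by linarith)
      _ < ε ^ 2 := by linarith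
  exact lt_of_pow_lt_pow_left₀ 2 hε.le h1

/-- `q` is dominated, along `ι`, by the quadratic form of a positive compact operator. -/
def CompactlyDominated (ι : D → H) (q : D → ℝ≥0∞) : Prop :=
  ∃ R : H →L[ℂ] H, IsCompactOperator R ∧ (∀ x, 0 ≤ RCLike.re ⟪R x, x⟫_ℂ) ∧
    ∀ z, q z ≤ ENNReal.ofReal (RCLike.re ⟪R (ι z), ι z⟫_ℂ)

theorem CompactlyDominated.mono {p q : D → ℝ≥0∞} (hq : CompactlyDominated ι q)
    (h : ∀ z, p z ≤ q z) : CompactlyDominated ι p := by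
  obtain ⟨R, h1, h2, h3⟩ := hq
  exact ⟨R, h1, h2, fun z => (h z).trans (h3 z)⟩

theorem CompactlyDominated.add {p q : D → ℝ≥0∞} (hp : CompactlyDominated ι p)
    (hq : CompactlyDominated ι q) : CompactlyDominated ι (fun z => p z + q z) := by
  obtain ⟨R, h1, h2, h3⟩ := hp
  obtain ⟨R', h1', h2', h3'⟩ := hq
  refine ⟨R + R', h1.add h1', fun x => ?_, fun z => ?_⟩
  · rw [add_apply, inner_add_left, map_add]
    exact add_nonneg (h2 x) (h2' x)
  -- `ENNReal.ofReal` truncates negative numbers; its additivity is where nonnegativity of the two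
  -- forms enters.
  · rw [add_apply, inner_add_left, map_add, ENNReal.ofReal_add (h2 _) (h2' _)]
    exact add_le_add (h3 z) (h3' z)

theorem CompactlyDominated.const_mul {q : D → ℝ≥0∞} (hq : CompactlyDominated ι q) (c : ℝ≥0) :
    CompactlyDominated ι (fun z => c * q z) := by
  obtain ⟨R, h1, h2, h3⟩ := hq
  have e : ∀ x, RCLike.re ⟪((c : ℂ) • R) x, x⟫_ℂ = c * RCLike.re ⟪R x, x⟫_ℂ := by
    intro x
    rw [smul_apply, inner_smul_left]
    simp
  refine ⟨(c : ℂ) • R, h1.smul _, fun x => ?_, fun z => ?_⟩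
  · rw [e]
    exact mul_nonneg c.2 (h2 x)
  · rw [e, ENNReal.ofReal_mul c.coe_nonneg, ENNReal.ofReal_coe_nnreal]
    exact mul_le_mul_right (h3 z) _

variable [CompleteSpace H]

theorem CompactlyDominated.comp {q : D → ℝ≥0∞} (hq : CompactlyDominated ι q) {φ : D → D}
    (L : H →L[ℂ] H) (h : ∀ z, ι (φ z) = L (ι z)) :
    CompactlyDominated ι (fun z => q (φ z)) := by
  obtain ⟨R, h1, h2, h3⟩ := hq
  refine ⟨(ContinuousLinearMap.adjoint L).comp (R.comp L), ?_, fun x => ?_, fun z => ?_⟩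
  · exact (h1.comp_clm L).clm_comp (ContinuousLinearMap.adjoint L)
  · rw [ContinuousLinearMap.comp_apply, ContinuousLinearMap.adjoint_inner_left]
    exact h2 (L x)
  · rw [ContinuousLinearMap.comp_apply, ContinuousLinearMap.adjoint_inner_left,
      ContinuousLinearMap.comp_apply, ← h]
    exact h3 (φ z)

variable {K : Type*} [NormedAddCommGroup K] [InnerProductSpace ℂ K] [CompleteSpace K]

theorem re_inner_adjoint_comp_self (L : H →L[ℂ] K) (x : H) :
    RCLike.re ⟪((ContinuousLinearMap.adjoint L).comp L) x, x⟫_ℂ = ‖L x‖ ^ 2 := by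
  rw [ContinuousLinearMap.comp_apply, ContinuousLinearMap.adjoint_inner_left,
    inner_self_eq_norm_sq]

theorem ofReal_norm_sq {E : Type*} [NormedAddCommGroup E] (x : E) :
    ENNReal.ofReal (‖x‖ ^ 2) = ‖x‖ₑ ^ 2 := by
  rw [ENNReal.ofReal_pow (norm_nonneg _), ofReal_norm]

theorem compactlyDominated_of_isCompactOperator (L : H →L[ℂ] K) (hL : IsCompactOperator L) :
    CompactlyDominated ι (fun z => ‖L (ι z)‖ₑ ^ 2) := by
  refine ⟨(ContinuousLinearMap.adjoint L).comp L,
    hL.clm_comp (ContinuousLinearMap.adjoint L), fun x => ?_, fun z => ?_⟩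
  · rw [re_inner_adjoint_comp_self]
    positivity
  · rw [re_inner_adjoint_comp_self, ofReal_norm_sq]

/-- The compact operators form a closed subspace, and the Bochner integral has zero image in the
quotient by it. Without integrability the integral is `0` by convention. -/
theorem isCompactOperator_integral {X : Type*} [MeasurableSpace X] {μ : Measure X}
    {F : X → H →L[ℂ] H} (h : ∀ᵐ t ∂μ, IsCompactOperator (F t)) :
    IsCompactOperator (∫ t, F t ∂μ : H →L[ℂ] H) := by
  by_cases hF : Integrable F μ
  · let V : Submodule ℂ (H →L[ℂ] H) := compactOperator (RingHom.id ℂ) H H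
    have hV : IsClosed (V : Set (H →L[ℂ] H)) := isClosed_setOfPred_isCompactOperator
    have h1 := V.mkQL.integral_comp_comm hF
    have h2 : ∫ t, V.mkQL (F t) ∂μ = 0 := by
      refine integral_eq_zero_of_ae ?_
      filter_upwards [h] with t ht
      exact (Submodule.Quotient.mk_eq_zero V).2 ht
    exact (Submodule.Quotient.mk_eq_zero V).1 (h1.symm.trans h2)
  · rw [integral_undef hF]
    exact isCompactOperator_zero

/-- The dominating operator is `R = ∫ G(t)* G(t) dt`, which converges in operator norm because `‖G*
G‖ ≤ ‖G‖²`; its quadratic form is exactly the given integral. -/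
theorem compactlyDominated_lintegral {X : Type*} [MeasurableSpace X] {μ : Measure X}
    {G : X → H →L[ℂ] K} (hG : MemLp G 2 μ) (hc : ∀ᵐ t ∂μ, IsCompactOperator (G t)) :
    CompactlyDominated ι (fun z => ∫⁻ t, ‖G t (ι z)‖ₑ ^ 2 ∂μ) := by
  let F : X → H →L[ℂ] H := fun t => (ContinuousLinearMap.adjoint (G t)).comp (G t)
  have hcont : Continuous fun L : H →L[ℂ] K => (ContinuousLinearMap.adjoint L).comp L :=
    (ContinuousLinearMap.adjoint (𝕜 := ℂ) (E := H) (F := K)).continuous.clm_comp continuous_id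
  have hF : Integrable F μ := by
    refine (hG.integrable_norm_pow (by norm_num)).mono'
      (hcont.comp_aestronglyMeasurable hG.1) (Eventually.of_forall fun t => ?_)
    refine (ContinuousLinearMap.opNorm_comp_le _ _).trans (le_of_eq ?_)
    rw [LinearIsometryEquiv.norm_map]
    simp [sq]
  have hre : ∀ x, RCLike.re ⟪(∫ t, F t ∂μ : H →L[ℂ] H) x, x⟫_ℂ = ∫ t, ‖G t x‖ ^ 2 ∂μ := by
    intro x
    -- The real functional `L ↦ Re ⟪L x, x⟫`, written as `Re ⟪x, L x⟫` so that it is built from the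
    -- linear slot.
    let e : (H →L[ℂ] H) →L[ℝ] ℝ :=
      (Complex.reCLM.comp (((innerSL ℂ x).comp
        (ContinuousLinearMap.apply ℂ H x)).restrictScalars ℝ))
    have he : ∀ L : H →L[ℂ] H, e L = RCLike.re ⟪L x, x⟫_ℂ := fun L => by
      rw [← inner_re_symm]
      rfl
    rw [← he, ← ContinuousLinearMap.integral_comp_comm e hF]
    simp only [he, F, re_inner_adjoint_comp_self]
  refine ⟨∫ t, F t ∂μ, isCompactOperator_integral ?_, fun x => ?_, fun z => ?_⟩
  · filter_upwards [hc] with t ht using ht.clm_comp (ContinuousLinearMap.adjoint (G t))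
  · rw [hre]
    positivity
  · rw [hre, ofReal_integral_eq_lintegral_ofReal]
    · simp only [ofReal_norm_sq]
      exact le_rfl
    · refine (hG.integrable_norm_pow (by norm_num)).mul_const (‖ι z‖ ^ 2) |>.mono' ?_
        (Eventually.of_forall fun t => ?_)
      · exact (((ContinuousLinearMap.apply ℂ K (ι z)).continuous.comp_aestronglyMeasurable
          hG.1).norm.pow 2)
      · rw [Real.norm_of_nonneg (by positivity), ← mul_pow]
        have := (G t).le_opNorm (ι z)
        gcongr
    · exact Eventually.of_forall fun t => by positivity

theorem CompactlyDominated.isCompactOperator {X : Type*} [NormedAddCommGroup X] [NormedSpace ℂ X]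
    [CompleteSpace X] (hι : DenseRange ι) {L : H →L[ℂ] X}
    (h : CompactlyDominated ι (fun z => ‖L (ι z)‖ₑ ^ 2)) : IsCompactOperator L := by
  obtain ⟨R, h1, h2, h3⟩ := h
  refine isCompactOperator_of_sq_norm_le L R h1 fun x => ?_
  refine hι.induction_on (p := fun x => ‖L x‖ ^ 2 ≤ RCLike.re ⟪R x, x⟫_ℂ) x ?_ fun z => ?_
  · refine isClosed_le (by fun_prop) ?_
    exact RCLike.continuous_re.comp (R.continuous.inner continuous_id)
  · exact (ENNReal.ofReal_le_ofReal_iff (h2 _)).1 ((ofReal_norm_sq _).trans_le (h3 z))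

end Compactness

/-! ### Comparison of the two outputs -/

section Comparison

open scoped ENNReal

variable {H : Type*} [NormedAddCommGroup H] [InnerProductSpace ℂ H] [CompleteSpace H]
variable {U : Type*} [NormedAddCommGroup U] [InnerProductSpace ℂ U] [CompleteSpace U]

theorem enorm_add_sq_le {E : Type*} [NormedAddCommGroup E] (a b : E) :
    ‖a + b‖ₑ ^ 2 ≤ 2 * ‖a‖ₑ ^ 2 + 2 * ‖b‖ₑ ^ 2 := by
  have h : ‖a + b‖₊ ^ 2 ≤ 2 * ‖a‖₊ ^ 2 + 2 * ‖b‖₊ ^ 2 := by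
    refine (pow_le_pow_left₀ zero_le (nnnorm_add_le a b) 2).trans ?_
    rw [← mul_add]
    exact add_sq_le
  simp only [enorm_eq_nnnorm]
  exact_mod_cast h

theorem enorm_sq_apply_le {E F : Type*} [NormedAddCommGroup E] [NormedSpace ℂ E]
    [NormedAddCommGroup F] [NormedSpace ℂ F] (L : E →L[ℂ] F) (x : E) :
    ‖L x‖ₑ ^ 2 ≤ (‖L‖₊ ^ 2 : ℝ≥0) * ‖x‖ₑ ^ 2 := by
  rw [ENNReal.coe_pow, ← mul_pow]
  gcongr
  exact L.le_opENorm x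

namespace C0Semigroup

variable {S S₁ S₂ : C0Semigroup H} {A : H →ₗ.[ℂ] H} {P : H →L[ℂ] H}

theorem IsGeneratedBy.adj_genAt_iff (hA : S.IsGeneratedBy A) {z y : H} :
    S.adj.GenAt z y ↔ ∀ x x', S.GenAt x x' → ⟪y, x⟫_ℂ = ⟪z, x'⟫_ℂ := by
  constructor
  · rintro h x x' hx
    obtain ⟨w, rfl, rfl⟩ := hA.exists_of_adj_genAt h
    obtain ⟨x, rfl, rfl⟩ := hA.exists_of_genAt hx
    exact LinearPMap.adjoint_isFormalAdjoint hA.dense w x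
  · intro h
    have key : ∀ x : A.domain, ⟪y, (x : H)⟫_ℂ = ⟪z, A x⟫_ℂ := fun x => h _ _ (hA.genAt x)
    have h1 := hA.adj_genAt ⟨z, LinearPMap.mem_adjoint_domain_of_exists _ ⟨y, key⟩⟩
    have h2 : AdjointDomain.op A ⟨z, LinearPMap.mem_adjoint_domain_of_exists _ ⟨y, key⟩⟩ = y :=
      LinearPMap.adjoint_apply_eq hA.dense _ key
    rw [h2] at h1
    exact h1

/-- This is `(A + P)* = A* + P*` with equal domains, in the form the variation of constants formulas
take. It is checked weakly, by moving `P` across the inner product. -/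
theorem adj_genAt_perturbed_iff (hA₁ : S₁.IsGeneratedBy A)
    (hA₂ : S₂.IsGeneratedBy (A.boundedPerturbation P)) (z y : H) :
    S₂.adj.GenAt z (y + ContinuousLinearMap.adjoint P z) ↔ S₁.adj.GenAt z y := by
  have h : ∀ x x', S₂.GenAt x x' ↔ S₁.GenAt x (x' - P x) := fun x x' => by
    rw [GenAt, GenAt, ← hA₂, mem_graph_boundedPerturbation, hA₁]
  rw [hA₂.adj_genAt_iff, hA₁.adj_genAt_iff]
  constructor
  · intro h1 x x' hx
    have h2 := h1 x (x' + P x) ((h _ _).2 (by rwa [add_sub_cancel_right]))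
    rw [inner_add_left, inner_add_right, ContinuousLinearMap.adjoint_inner_left] at h2
    exact add_right_cancel h2
  · intro h1 x x' hx
    have h2 := h1 x (x' - P x) ((h _ _).1 hx)
    rw [inner_add_left, h2, inner_sub_right, ContinuousLinearMap.adjoint_inner_left,
      sub_add_cancel]

theorem exists_incl_eq (hA₁ : S₁.IsGeneratedBy A)
    (hA₂ : S₂.IsGeneratedBy (A.boundedPerturbation P)) (z : AdjointDomain A) :
    ∃ w : AdjointDomain (A.boundedPerturbation P),
      AdjointDomain.incl (A.boundedPerturbation P) w = AdjointDomain.incl A z := by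
  obtain ⟨w, hw, -⟩ :=
    hA₂.exists_of_adj_genAt ((adj_genAt_perturbed_iff hA₁ hA₂ _ _).2 (hA₁.adj_genAt z))
  exact ⟨w, hw⟩

theorem genAt_incl_perturbed (hA₁ : S₁.IsGeneratedBy A)
    (hA₂ : S₂.IsGeneratedBy (A.boundedPerturbation P)) (z : AdjointDomain A) :
    ∃ y, S₂.adj.GenAt (AdjointDomain.incl A z) y :=
  ⟨_, (adj_genAt_perturbed_iff hA₁ hA₂ _ _).2 (hA₁.adj_genAt z)⟩

variable (hA₁ : S₁.IsGeneratedBy A) (hA₂ : S₂.IsGeneratedBy (A.boundedPerturbation P))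

/-- The vector `z ∈ D(A*)`, as an element of `D((A + P)*)`. -/
def toPerturbed (z : AdjointDomain A) : AdjointDomain (A.boundedPerturbation P) :=
  (exists_incl_eq hA₁ hA₂ z).choose

theorem incl_toPerturbed (z : AdjointDomain A) :
    AdjointDomain.incl (A.boundedPerturbation P) (toPerturbed hA₁ hA₂ z)
      = AdjointDomain.incl A z :=
  (exists_incl_eq hA₁ hA₂ z).choose_spec

theorem ofPerturbed_toPerturbed (z : AdjointDomain A) :
    AdjointDomain.ofPerturbed A P (toPerturbed hA₁ hA₂ z) = z := by
  apply AdjointDomain.incl_injective A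
  rw [AdjointDomain.incl_ofPerturbed, incl_toPerturbed]

theorem controlAdjointL_perturbed (B : U →L[ℂ] AdjointDomainDual A)
    (w : AdjointDomain (A.boundedPerturbation P)) :
    controlAdjointL (perturbedControl B P) w
      = controlAdjointL B (AdjointDomain.ofPerturbed A P w) := by
  refine ext_inner_right ℂ fun v => ?_
  rw [controlAdjointL_apply, controlAdjointL_apply, inner_controlAdjoint, inner_controlAdjoint]
  rfl

variable {B : U →L[ℂ] AdjointDomainDual A}

variable {hA₁} in
/-- The inequality of observation is stable under bounded perturbations. -/
theorem ObsBound.perturbed {T : ℝ} (h : ObsBound hA₁ B T) :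
    ObsBound hA₂ (perturbedControl B P) T := by
  obtain ⟨K, hK⟩ := h.exists_conv_bound
  obtain ⟨N, hN⟩ := h
  obtain ⟨M, -, hM⟩ := S₂.adj.exists_bound T
  set Q := ContinuousLinearMap.adjoint P
  refine ⟨2 * (K * (‖Q‖₊ ^ 2 * M.toNNReal ^ 2 * T.toNNReal)) + 2 * N, fun y => ?_⟩
  set z := AdjointDomain.ofPerturbed A P y
  set x := AdjointDomain.incl A z
  have hyx : AdjointDomain.incl (A.boundedPerturbation P) y = x :=
    (AdjointDomain.incl_ofPerturbed A P y).symm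
  -- `w(t) = S₂(t)* z - S₁(t)* z` is the `S₁`-convolution of `P* S₂(s)* z`, so the convolution bound
  -- for the unperturbed pair applies to it.
  let w : ℝ → AdjointDomain A := fun t =>
    AdjointDomain.ofPerturbed A P (S₂.adjointRestrict hA₂ t y) - S₁.adjointRestrict hA₁ t z
  have hw : ∀ t ∈ Ioc 0 T, AdjointDomain.incl A (w t)
      = S₁.adj.conv (fun s => Q (S₂.adj.opAt s x)) t := by
    intro t ht
    obtain ⟨y', hy'⟩ := genAt_incl_perturbed hA₁ hA₂ z
    have h1 := hy'.eq_opAt_add_conv (adj_genAt_perturbed_iff hA₁ hA₂) ht.1.le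
    rw [map_sub, AdjointDomain.incl_ofPerturbed, incl_adjointRestrict_eq, incl_adjointRestrict_eq,
      hyx, h1, add_sub_cancel_left]
  have h1 := hK _ w (Q.continuous.comp (S₂.adj.continuous_opAt_apply x)) hw
  have h2 : ∫⁻ t in Ioc 0 T, ‖Q (S₂.adj.opAt t x)‖ₑ ^ 2
      ≤ (‖Q‖₊ ^ 2 * M.toNNReal ^ 2 * T.toNNReal : ℝ≥0) * ‖x‖ₑ ^ 2 := by
    calc ∫⁻ t in Ioc 0 T, ‖Q (S₂.adj.opAt t x)‖ₑ ^ 2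
        ≤ ∫⁻ t in Ioc 0 T, (‖Q‖₊ ^ 2 * M.toNNReal ^ 2 : ℝ≥0) * ‖x‖ₑ ^ 2 := by
          refine setLIntegral_mono' measurableSet_Ioc fun t ht => ?_
          refine (enorm_sq_apply_le Q _).trans ?_
          rw [ENNReal.coe_mul, mul_assoc, ENNReal.coe_pow M.toNNReal, ← mul_pow]
          gcongr
          exact S₂.adj.enorm_opAt_le (hM t ht.2) x
      _ = _ := by
          rw [setLIntegral_const, Real.volume_Ioc, sub_zero, ENNReal.coe_mul _ T.toNNReal,
            mul_right_comm]
          rfl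
  have h3 : ∀ t, ‖controlAdjointL (perturbedControl B P) (S₂.adjointRestrict hA₂ t y)‖ₑ ^ 2
      ≤ 2 * ‖controlAdjointL B (w t)‖ₑ ^ 2
        + 2 * ‖controlAdjointL B (S₁.adjointRestrict hA₁ t z)‖ₑ ^ 2 := by
    intro t
    have e : AdjointDomain.ofPerturbed A P (S₂.adjointRestrict hA₂ t y)
        = w t + S₁.adjointRestrict hA₁ t z := (sub_add_cancel _ _).symm
    rw [controlAdjointL_perturbed, e, map_add]
    exact enorm_add_sq_le _ _
  rw [hyx]
  calc energy hA₂ (perturbedControl B P) T y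
      ≤ ∫⁻ t in Ioc 0 T, (2 * ‖controlAdjointL B (w t)‖ₑ ^ 2
        + 2 * ‖controlAdjointL B (S₁.adjointRestrict hA₁ t z)‖ₑ ^ 2) := lintegral_mono h3
    _ = 2 * (∫⁻ t in Ioc 0 T, ‖controlAdjointL B (w t)‖ₑ ^ 2) + 2 * energy hA₁ B T z := by
        rw [lintegral_add_right _
          (((continuous_output hA₁ B z).enorm.measurable.pow_const 2).const_mul 2),
          lintegral_const_mul' _ _ (by norm_num), lintegral_const_mul' _ _ (by norm_num), energy]
    _ ≤ 2 * (K * ((‖Q‖₊ ^ 2 * M.toNNReal ^ 2 * T.toNNReal : ℝ≥0) * ‖x‖ₑ ^ 2))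
          + 2 * (N * ‖x‖ₑ ^ 2) := by
        gcongr
        · exact h1.trans (mul_le_mul' le_rfl h2)
        · exact hN z
    _ = _ := by
        push_cast
        ring

variable (B) in
/-- The energy of the difference of the two outputs. -/
def diffEnergy (T : ℝ) (z : AdjointDomain A) : ℝ≥0∞ :=
  ∫⁻ t in Ioc 0 T, ‖controlAdjointL (perturbedControl B P)
      (S₂.adjointRestrict hA₂ t (toPerturbed hA₁ hA₂ z))
    - controlAdjointL B (S₁.adjointRestrict hA₁ t z)‖ₑ ^ 2

variable {K : Type*} [NormedAddCommGroup K] [InnerProductSpace ℂ K] [CompleteSpace K]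
  {G : ℝ → (H →L[ℂ] K)} {ε : ℝ} {c : ℝ≥0}

variable {hA₁ hA₂} in
-- Split the difference of states into the Dyson term, bounded pointwise by `G(t) z`, and an
-- `S₂`-convolution of `P*` times the Dyson term, bounded in `L²` by the observation inequality of
-- the perturbed pair.
theorem exists_diffEnergy_le (hobs : ObsBound hA₂ (perturbedControl B P) ε)
    (hG : AEStronglyMeasurable G (volume.restrict (Ioc 0 ε)))
    (hb : ∀ᵐ t ∂(volume.restrict (Ioc 0 ε)), ∀ z w : AdjointDomain A,
      AdjointDomain.incl A w
          = S₁.adj.dyson (ContinuousLinearMap.adjoint P) t (AdjointDomain.incl A z) →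
        ‖controlAdjointL B w‖ₑ ≤ c * ‖G t (AdjointDomain.incl A z)‖ₑ ∧
        ‖S₁.adj.dyson (ContinuousLinearMap.adjoint P) t (AdjointDomain.incl A z)‖ₑ
          ≤ c * ‖G t (AdjointDomain.incl A z)‖ₑ) :
    ∃ M : ℝ≥0, ∀ z, diffEnergy hA₁ hA₂ B ε z
      ≤ M * ∫⁻ t in Ioc 0 ε, ‖G t (AdjointDomain.incl A z)‖ₑ ^ 2 := by
  obtain ⟨N, hN⟩ := hobs.exists_conv_bound
  set Q := ContinuousLinearMap.adjoint P
  refine ⟨2 * c ^ 2 + 2 * (N * (‖Q‖₊ ^ 2 * c ^ 2)), fun z => ?_⟩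
  set x := AdjointDomain.incl A z
  have hl : ∀ t, ∃ l : AdjointDomain A, 0 ≤ t → AdjointDomain.incl A l = S₁.adj.dyson Q t x := by
    intro t
    by_cases ht : 0 ≤ t
    · obtain ⟨l, hl, -⟩ := hA₁.exists_of_adj_genAt ((hA₁.adj_genAt z).dyson Q ht)
      exact ⟨l, fun _ => hl⟩
    · exact ⟨0, fun h => absurd h ht⟩
  choose l hl using hl
  -- The remainder is formed in `D(A*)`, where the Dyson term `l t` lives, and then moved to `D((A +
  -- P)*)`, where the convolution bound for `S₂` is stated.
  let m : ℝ → AdjointDomain A := fun t => AdjointDomain.ofPerturbed A P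
    (S₂.adjointRestrict hA₂ t (toPerturbed hA₁ hA₂ z)) - S₁.adjointRestrict hA₁ t z - l t
  let w := fun t => toPerturbed hA₁ hA₂ (m t)
  have hw : ∀ t ∈ Ioc 0 ε, AdjointDomain.incl _ (w t)
      = S₂.adj.conv (fun s => Q (S₁.adj.dyson Q s x)) t := by
    intro t ht
    have h1 := (hA₁.adj_genAt z).opAt_sub_eq_dyson_add_conv
      (adj_genAt_perturbed_iff hA₁ hA₂) ht.1.le
    rw [incl_toPerturbed, map_sub, map_sub, AdjointDomain.incl_ofPerturbed,
      incl_adjointRestrict_eq, incl_adjointRestrict_eq, incl_toPerturbed, h1, hl t ht.1.le,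
      add_sub_cancel_left]
  have h1 := hN _ w (Q.continuous.comp (S₁.adj.continuous_dyson_apply Q x)) hw
  have h2 : ∫⁻ t in Ioc 0 ε, ‖Q (S₁.adj.dyson Q t x)‖ₑ ^ 2
      ≤ (‖Q‖₊ ^ 2 * c ^ 2 : ℝ≥0) * ∫⁻ t in Ioc 0 ε, ‖G t x‖ₑ ^ 2 := by
    rw [← lintegral_const_mul' _ _ ENNReal.coe_ne_top]
    refine lintegral_mono_ae ?_
    filter_upwards [hb, ae_restrict_mem measurableSet_Ioc] with t ht ht'
    refine (enorm_sq_apply_le Q _).trans ?_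
    rw [ENNReal.coe_mul, mul_assoc, ENNReal.coe_pow c, ← mul_pow]
    gcongr
    exact (ht z (l t) (hl t ht'.1.le)).2
  have h3 : ∀ᵐ t ∂(volume.restrict (Ioc 0 ε)), ‖controlAdjointL (perturbedControl B P)
        (S₂.adjointRestrict hA₂ t (toPerturbed hA₁ hA₂ z))
      - controlAdjointL B (S₁.adjointRestrict hA₁ t z)‖ₑ ^ 2
      ≤ (2 * c ^ 2 : ℝ≥0) * ‖G t x‖ₑ ^ 2
        + 2 * ‖controlAdjointL (perturbedControl B P) (w t)‖ₑ ^ 2 := by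
    filter_upwards [hb, ae_restrict_mem measurableSet_Ioc] with t ht ht'
    have e : controlAdjointL (perturbedControl B P)
        (S₂.adjointRestrict hA₂ t (toPerturbed hA₁ hA₂ z))
        - controlAdjointL B (S₁.adjointRestrict hA₁ t z)
        = controlAdjointL B (l t) + controlAdjointL (perturbedControl B P) (w t) := by
      rw [controlAdjointL_perturbed, controlAdjointL_perturbed, ofPerturbed_toPerturbed,
        ← map_sub, ← map_add, add_sub_cancel]
    rw [e]
    refine (enorm_add_sq_le _ _).trans ?_
    rw [ENNReal.coe_mul, mul_assoc, ENNReal.coe_pow c, ← mul_pow]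
    gcongr
    · exact le_rfl
    · exact (ht z (l t) (hl t ht'.1.le)).1
  have hGm : AEMeasurable (fun t => (2 * c ^ 2 : ℝ≥0) * ‖G t x‖ₑ ^ 2)
      (volume.restrict (Ioc 0 ε)) :=
    ((((ContinuousLinearMap.apply ℂ K x).continuous.comp_aestronglyMeasurable
      hG).enorm).pow_const 2).const_mul _
  calc diffEnergy hA₁ hA₂ B ε z
      ≤ ∫⁻ t in Ioc 0 ε, ((2 * c ^ 2 : ℝ≥0) * ‖G t x‖ₑ ^ 2
        + 2 * ‖controlAdjointL (perturbedControl B P) (w t)‖ₑ ^ 2) := lintegral_mono_ae h3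
    _ = (2 * c ^ 2 : ℝ≥0) * (∫⁻ t in Ioc 0 ε, ‖G t x‖ₑ ^ 2)
        + 2 * ∫⁻ t in Ioc 0 ε, ‖controlAdjointL (perturbedControl B P) (w t)‖ₑ ^ 2 := by
        rw [lintegral_add_left' hGm, lintegral_const_mul' _ _ ENNReal.coe_ne_top,
          lintegral_const_mul' _ _ (by norm_num)]
    _ ≤ (2 * c ^ 2 : ℝ≥0) * (∫⁻ t in Ioc 0 ε, ‖G t x‖ₑ ^ 2)
        + 2 * (N * ((‖Q‖₊ ^ 2 * c ^ 2 : ℝ≥0) * ∫⁻ t in Ioc 0 ε, ‖G t x‖ₑ ^ 2)) := by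
        gcongr
        exact h1.trans (mul_le_mul' le_rfl h2)
    _ = _ := by
        push_cast
        ring

/-- The same splitting measured in `H` instead of through `B*`: Cauchy–Schwarz in time and the local
bound on `S₂` suffice, so admissibility plays no role. Its purpose is compactness of `S₂(τ)* -
S₁(τ)*` at a suitable `τ`. -/
theorem exists_opAt_sub_le (hA₁ : S₁.IsGeneratedBy A)
    (hA₂ : S₂.IsGeneratedBy (A.boundedPerturbation P))
    (hb : ∀ᵐ t ∂(volume.restrict (Ioc 0 ε)), ∀ z : AdjointDomain A,
        ‖S₁.adj.dyson (ContinuousLinearMap.adjoint P) t (AdjointDomain.incl A z)‖ₑ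
          ≤ c * ‖G t (AdjointDomain.incl A z)‖ₑ) :
    ∃ M : ℝ≥0, ∀ᵐ t ∂(volume.restrict (Ioc 0 ε)), ∀ z : AdjointDomain A,
      ‖(S₂.adj.opAt t - S₁.adj.opAt t) (AdjointDomain.incl A z)‖ₑ ^ 2
        ≤ M * (‖G t (AdjointDomain.incl A z)‖ₑ ^ 2
          + ∫⁻ s in Ioc 0 ε, ‖G s (AdjointDomain.incl A z)‖ₑ ^ 2) := by
  obtain ⟨N, -, hN⟩ := S₂.adj.exists_bound ε
  set Q := ContinuousLinearMap.adjoint P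
  refine ⟨2 * c ^ 2 + 2 * (ε.toNNReal * (N.toNNReal ^ 2 * (‖Q‖₊ ^ 2 * c ^ 2))), ?_⟩
  filter_upwards [hb, ae_restrict_mem measurableSet_Ioc] with t ht ht' z
  set x := AdjointDomain.incl A z
  have h1 := (hA₁.adj_genAt z).opAt_sub_eq_dyson_add_conv
      (adj_genAt_perturbed_iff hA₁ hA₂) ht'.1.le
  have h2 : ‖S₂.adj.conv (fun s => Q (S₁.adj.dyson Q s x)) t‖ₑ ^ 2
      ≤ (ε.toNNReal * (N.toNNReal ^ 2 * (‖Q‖₊ ^ 2 * c ^ 2)) : ℝ≥0)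
        * ∫⁻ s in Ioc 0 ε, ‖G s x‖ₑ ^ 2 := by
    rw [conv, intervalIntegral.integral_of_le ht'.1.le]
    have hm : Continuous fun s => S₂.adj.opAt (t - s) (Q (S₁.adj.dyson Q s x)) :=
      S₂.adj.continuous_opAt (by fun_prop) (Q.continuous.comp (S₁.adj.continuous_dyson_apply Q x))
    calc ‖∫ s in Ioc 0 t, S₂.adj.opAt (t - s) (Q (S₁.adj.dyson Q s x))‖ₑ ^ 2
        ≤ (∫⁻ s in Ioc 0 t, ‖S₂.adj.opAt (t - s) (Q (S₁.adj.dyson Q s x))‖ₑ) ^ 2 := by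
          gcongr
          exact enorm_integral_le_lintegral_enorm _
      _ ≤ volume.restrict (Ioc 0 t) univ
            * ∫⁻ s in Ioc 0 t, ‖S₂.adj.opAt (t - s) (Q (S₁.adj.dyson Q s x))‖ₑ ^ 2 :=
          sq_lintegral_le hm.enorm.measurable.aemeasurable
      _ ≤ ENNReal.ofReal ε
            * ∫⁻ s in Ioc 0 t, (N.toNNReal ^ 2 * (‖Q‖₊ ^ 2 * c ^ 2) : ℝ≥0) * ‖G s x‖ₑ ^ 2 := by
          rw [Measure.restrict_apply_univ, Real.volume_Ioc, sub_zero]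
          refine mul_le_mul' (ENNReal.ofReal_le_ofReal ht'.2) (lintegral_mono_ae ?_)
          filter_upwards [ae_restrict_mem measurableSet_Ioc,
            ae_restrict_of_ae_restrict_of_subset (Ioc_subset_Ioc_right ht'.2) hb] with s hs hs'
          calc ‖S₂.adj.opAt (t - s) (Q (S₁.adj.dyson Q s x))‖ₑ ^ 2
              ≤ (ENNReal.ofReal N * ‖Q (S₁.adj.dyson Q s x)‖ₑ) ^ 2 := by
                gcongr
                exact S₂.adj.enorm_opAt_le (hN _ (by linarith [hs.1, ht'.2])) _
            _ ≤ (N.toNNReal ^ 2 : ℝ≥0) * ((‖Q‖₊ ^ 2 : ℝ≥0) * (c * ‖G s x‖ₑ) ^ 2) := by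
                rw [mul_pow, ENNReal.coe_pow]
                refine mul_le_mul' le_rfl ((enorm_sq_apply_le Q _).trans ?_)
                gcongr
                exact hs' z
            _ = _ := by
                push_cast
                ring
      _ ≤ ENNReal.ofReal ε
            * ∫⁻ s in Ioc 0 ε, (N.toNNReal ^ 2 * (‖Q‖₊ ^ 2 * c ^ 2) : ℝ≥0) * ‖G s x‖ₑ ^ 2 := by
          gcongr
          exact ht'.2
      _ = _ := by
          rw [lintegral_const_mul' _ _ ENNReal.coe_ne_top, ENNReal.coe_mul ε.toNNReal, mul_assoc]
          rfl
  rw [sub_apply, h1]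
  refine (enorm_add_sq_le _ _).trans ?_
  have h3 : ‖S₁.adj.dyson Q t x‖ₑ ^ 2 ≤ (c ^ 2 : ℝ≥0) * ‖G t x‖ₑ ^ 2 := by
    rw [ENNReal.coe_pow, ← mul_pow]
    gcongr
    exact ht z
  set I := ∫⁻ s in Ioc 0 ε, ‖G s x‖ₑ ^ 2
  set b : ℝ≥0 := ε.toNNReal * (N.toNNReal ^ 2 * (‖Q‖₊ ^ 2 * c ^ 2))
  calc 2 * ‖S₁.adj.dyson Q t x‖ₑ ^ 2
        + 2 * ‖S₂.adj.conv (fun s => Q (S₁.adj.dyson Q s x)) t‖ₑ ^ 2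
      ≤ 2 * ((c ^ 2 : ℝ≥0) * ‖G t x‖ₑ ^ 2) + 2 * (b * I) := by gcongr
    -- The cross terms are added so that one constant factors out of the sum.
    _ ≤ (2 * ((c ^ 2 : ℝ≥0) * ‖G t x‖ₑ ^ 2) + 2 * (b * I))
        + (2 * ((c ^ 2 : ℝ≥0) * I) + 2 * (b * ‖G t x‖ₑ ^ 2)) := le_self_add
    _ = _ := by
        push_cast
        ring

theorem diffEnergy_mono {a b : ℝ} (h : a ≤ b) (z : AdjointDomain A) :
    diffEnergy hA₁ hA₂ B a z ≤ diffEnergy hA₁ hA₂ B b z :=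
  lintegral_mono_set (Ioc_subset_Ioc_right h)

/-- After time `a`, compare both outputs with the `S₂`-output started from `S₁(a)* z`. This leaves a
difference of outputs over time `b` and the `S₂`-output of the state error at `a`, whose energy is
bounded by observation. -/
theorem diffEnergy_add_le {a b : ℝ} (ha : 0 ≤ a) (hb : 0 ≤ b) {M : ℝ≥0}
    (hM : ∀ y, energy hA₂ (perturbedControl B P) b y
      ≤ M * ‖AdjointDomain.incl (A.boundedPerturbation P) y‖ₑ ^ 2) (z : AdjointDomain A) :
    diffEnergy hA₁ hA₂ B (b + a) z ≤ diffEnergy hA₁ hA₂ B a z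
      + ((2 : ℝ≥0) * diffEnergy hA₁ hA₂ B b (S₁.adjointRestrict hA₁ a z)
        + (2 * M : ℝ≥0) * ‖(S₂.adj.opAt a - S₁.adj.opAt a) (AdjointDomain.incl A z)‖ₑ ^ 2) := by
  rw [diffEnergy, lintegral_Ioc_zero_add _ ha hb]
  refine add_le_add le_rfl ?_
  set z' := toPerturbed hA₁ hA₂ (S₁.adjointRestrict hA₁ a z)
  set y := S₂.adjointRestrict hA₂ a (toPerturbed hA₁ hA₂ z) - z'
  have hy : AdjointDomain.incl (A.boundedPerturbation P) y
      = (S₂.adj.opAt a - S₁.adj.opAt a) (AdjointDomain.incl A z) := by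
    rw [map_sub, incl_adjointRestrict_eq, incl_toPerturbed, incl_toPerturbed,
      incl_adjointRestrict_eq, sub_apply]
  have h1 : ∀ t ∈ Ioc 0 b, ‖controlAdjointL (perturbedControl B P)
        (S₂.adjointRestrict hA₂ (t + a) (toPerturbed hA₁ hA₂ z))
      - controlAdjointL B (S₁.adjointRestrict hA₁ (t + a) z)‖ₑ ^ 2
      ≤ 2 * ‖controlAdjointL (perturbedControl B P) (S₂.adjointRestrict hA₂ t z')
          - controlAdjointL B (S₁.adjointRestrict hA₁ t (S₁.adjointRestrict hA₁ a z))‖ₑ ^ 2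
        + 2 * ‖controlAdjointL (perturbedControl B P) (S₂.adjointRestrict hA₂ t y)‖ₑ ^ 2 := by
    intro t ht
    refine le_trans (le_of_eq ?_) (enorm_add_sq_le _ _)
    rw [adjointRestrict_add hA₂ ht.1.le ha, adjointRestrict_add hA₁ ht.1.le ha]
    simp only [y, map_sub]
    congr 2
    abel
  calc _ ≤ ∫⁻ t in Ioc 0 b, (2 * ‖controlAdjointL (perturbedControl B P)
          (S₂.adjointRestrict hA₂ t z')
          - controlAdjointL B (S₁.adjointRestrict hA₁ t (S₁.adjointRestrict hA₁ a z))‖ₑ ^ 2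
        + 2 * ‖controlAdjointL (perturbedControl B P) (S₂.adjointRestrict hA₂ t y)‖ₑ ^ 2) :=
        setLIntegral_mono' measurableSet_Ioc h1
    _ = 2 * diffEnergy hA₁ hA₂ B b (S₁.adjointRestrict hA₁ a z)
        + 2 * energy hA₂ (perturbedControl B P) b y := by
        rw [lintegral_add_right _
          (((continuous_output hA₂ _ y).enorm.measurable.pow_const 2).const_mul 2),
          lintegral_const_mul' _ _ (by norm_num), lintegral_const_mul' _ _ (by norm_num), energy,
          diffEnergy]
    _ ≤ _ := by
        rw [← hy, ENNReal.coe_mul, mul_assoc]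
        exact add_le_add le_rfl (mul_le_mul' le_rfl (hM y))

variable {hA₁ hA₂} in
theorem compactlyDominated_diffEnergy_nat_mul (hobs : ∀ T, ObsBound hA₂ (perturbedControl B P) T)
    {τ : ℝ} (hτ : 0 ≤ τ) (hc : IsCompactOperator (S₂.adj.opAt τ - S₁.adj.opAt τ))
    (h : CompactlyDominated (AdjointDomain.incl A) (diffEnergy hA₁ hA₂ B τ)) (n : ℕ) :
    CompactlyDominated (AdjointDomain.incl A) (diffEnergy hA₁ hA₂ B (n * τ)) := by
  induction n with
  -- The energy up to time `0` is dominated by the energy up to `τ`.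
  | zero => exact h.mono fun z => diffEnergy_mono hA₁ hA₂ (by simpa using hτ) z
  | succ n ih =>
    obtain ⟨M, hM⟩ := hobs (n * τ)
    refine (h.add (((ih.comp (S₁.adj.opAt τ) (incl_adjointRestrict_eq hA₁ τ)).const_mul 2).add
      ((compactlyDominated_of_isCompactOperator _ hc).const_mul (2 * M)))).mono fun z => ?_
    have e : ((n + 1 : ℕ) : ℝ) * τ = n * τ + τ := by
      push_cast
      ring
    rw [e]
    exact diffEnergy_add_le hA₁ hA₂ hτ (by positivity) hM z

variable {hA₁ hA₂} in
theorem enorm_adjoint_sub_sq {T : ℝ} (hT : 0 ≤ T) {Φ₁ Φ₂ : ControlSpace U →L[ℂ] H}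
    (h₁ : IsInputMap S₁ hA₁ B T Φ₁) (h₂ : IsInputMap S₂ hA₂ (perturbedControl B P) T Φ₂)
    (z : AdjointDomain A) :
    ‖(ContinuousLinearMap.adjoint Φ₁ - ContinuousLinearMap.adjoint Φ₂)
      (AdjointDomain.incl A z)‖ₑ ^ 2 = diffEnergy hA₁ hA₂ B T z := by
  have e1 : ContinuousLinearMap.adjoint Φ₂ (AdjointDomain.incl A z)
      = outputLp hA₂ (perturbedControl B P) T (toPerturbed hA₁ hA₂ z) := by
    rw [← h₂.adjoint_apply hT, incl_toPerturbed]
  rw [sub_apply, e1, h₁.adjoint_apply hT, enorm_Lp_two_sq, diffEnergy, ← lintegral_Ioc_reflect,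
    ← setLIntegral_indicator_enorm_sq]
  refine lintegral_congr_ae ?_
  filter_upwards [coeFn_outputLp hA₁ B T z,
    coeFn_outputLp hA₂ (perturbedControl B P) T (toPerturbed hA₁ hA₂ z),
    Lp.coeFn_sub (outputLp hA₁ B T z)
      (outputLp hA₂ (perturbedControl B P) T (toPerturbed hA₁ hA₂ z))] with s hs1 hs2 hs3
  rw [hs3, Pi.sub_apply, hs1, hs2, enorm_sub_rev]
  by_cases hs : s ∈ Ioc 0 T <;> simp [hs]

end C0Semigroup

end Comparison

end

theorem mainTheorem7
    {H : Type*} [NormedAddCommGroup H] [InnerProductSpace ℂ H] [CompleteSpace H]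
    {U : Type*} [NormedAddCommGroup U] [InnerProductSpace ℂ U] [CompleteSpace U]
    (A₁ : H →ₗ.[ℂ] H) (S₁ : C0Semigroup H) (hA₁ : S₁.IsGeneratedBy A₁)
    (B : U →L[ℂ] AdjointDomainDual A₁) (hB : IsAdmissible S₁ hA₁ B)
    (P : H →L[ℂ] H)
    {ε : ℝ} (hε : 0 < ε)
    {K : Type*} [NormedAddCommGroup K] [InnerProductSpace ℂ K] [CompleteSpace K]
    (G : ℝ → (H →L[ℂ] K)) (hG : MemLp G 2 (volume.restrict (Ioo 0 ε)))
    (hGcompact : ∀ᵐ t ∂(volume.restrict (Ioo 0 ε)), IsCompactOperator (G t))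
    {C : ℝ} (hC : 0 < C)
    (hbound : ∀ᵐ t ∂(volume.restrict (Ioo 0 ε)), ∀ z₀ w : AdjointDomain A₁,
      AdjointDomain.incl A₁ w = volterra S₁ P (AdjointDomain.incl A₁ z₀) t →
        ‖controlAdjoint B w‖ + ‖volterra S₁ P (AdjointDomain.incl A₁ z₀) t‖
          ≤ C * ‖G t (AdjointDomain.incl A₁ z₀)‖) :
    (∃ S₂ : C0Semigroup H, S₂.IsGeneratedBy (A₁.boundedPerturbation P)) ∧
    ∀ (S₂ : C0Semigroup H) (hA₂ : S₂.IsGeneratedBy (A₁.boundedPerturbation P)),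
      IsAdmissible S₂ hA₂ (perturbedControl B P) ∧
      ∀ T : ℝ, 0 < T →
        (∃ Φ₁ : ControlSpace U →L[ℂ] H, IsInputMap S₁ hA₁ B T Φ₁) ∧
        (∃ Φ₂ : ControlSpace U →L[ℂ] H, IsInputMap S₂ hA₂ (perturbedControl B P) T Φ₂) ∧
        ∀ Φ₁ Φ₂ : ControlSpace U →L[ℂ] H,
          IsInputMap S₁ hA₁ B T Φ₁ →
          IsInputMap S₂ hA₂ (perturbedControl B P) T Φ₂ →
          IsCompactOperator
            (ContinuousLinearMap.adjoint Φ₁ - ContinuousLinearMap.adjoint Φ₂) := by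
  have hIoc : volume.restrict (Ioo 0 ε) = volume.restrict (Ioc 0 ε) :=
    Measure.restrict_congr_set Ioo_ae_eq_Ioc
  rw [hIoc] at hG hGcompact hbound
  obtain ⟨T₀, hT₀, hobs₀⟩ := C0Semigroup.exists_obsBound hB
  have hobs₁ : ∀ T, C0Semigroup.ObsBound hA₁ B T := hobs₀.all hT₀
  refine ⟨hA₁.exists_boundedPerturbation P, fun S₂ hA₂ => ?_⟩
  have hobs₂ : ∀ T, C0Semigroup.ObsBound hA₂ (perturbedControl B P) T :=
    fun T => (hobs₁ T).perturbed hA₂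
  have hb : ∀ᵐ t ∂(volume.restrict (Ioc 0 ε)), ∀ z w : AdjointDomain A₁,
      AdjointDomain.incl A₁ w
          = S₁.adj.dyson (ContinuousLinearMap.adjoint P) t (AdjointDomain.incl A₁ z) →
        ‖controlAdjointL B w‖ₑ ≤ C.toNNReal * ‖G t (AdjointDomain.incl A₁ z)‖ₑ ∧
        ‖S₁.adj.dyson (ContinuousLinearMap.adjoint P) t (AdjointDomain.incl A₁ z)‖ₑ
          ≤ C.toNNReal * ‖G t (AdjointDomain.incl A₁ z)‖ₑ := by
    filter_upwards [hbound] with t ht z w hw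
    have h1 : ‖controlAdjointL B w‖
        + ‖S₁.adj.dyson (ContinuousLinearMap.adjoint P) t (AdjointDomain.incl A₁ z)‖
        ≤ C.toNNReal * ‖G t (AdjointDomain.incl A₁ z)‖ := by
      rw [Real.coe_toNNReal C hC.le]
      -- `volterra` for `S₁` unfolds to the Dyson term of the adjoint semigroup with `Q = P*`.
      exact ht z w hw
    have h2 : ‖controlAdjointL B w‖ ≤ C.toNNReal * ‖G t (AdjointDomain.incl A₁ z)‖ :=
      (le_add_of_nonneg_right (norm_nonneg _)).trans h1
    have h3 : ‖S₁.adj.dyson (ContinuousLinearMap.adjoint P) t (AdjointDomain.incl A₁ z)‖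
        ≤ C.toNNReal * ‖G t (AdjointDomain.incl A₁ z)‖ :=
      (le_add_of_nonneg_left (norm_nonneg _)).trans h1
    simp only [enorm_eq_nnnorm]
    exact ⟨by exact_mod_cast h2, by exact_mod_cast h3⟩
  have hb' : ∀ᵐ t ∂(volume.restrict (Ioc 0 ε)), ∀ z : AdjointDomain A₁,
      ‖S₁.adj.dyson (ContinuousLinearMap.adjoint P) t (AdjointDomain.incl A₁ z)‖ₑ
        ≤ C.toNNReal * ‖G t (AdjointDomain.incl A₁ z)‖ₑ := by
    filter_upwards [hb, ae_restrict_mem measurableSet_Ioc] with t ht ht' z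
    obtain ⟨w, hw, -⟩ := hA₁.exists_of_adj_genAt
      ((hA₁.adj_genAt z).dyson (ContinuousLinearMap.adjoint P) ht'.1.le)
    exact (ht z w hw).2
  have hGdom : CompactlyDominated (AdjointDomain.incl A₁)
      (fun z => ∫⁻ t in Ioc 0 ε, ‖G t (AdjointDomain.incl A₁ z)‖ₑ ^ 2) :=
    compactlyDominated_lintegral hG hGcompact
  -- Almost every `τ` works: it is enough that `G(τ)` is compact and that the pointwise estimate of
  -- the state error holds at `τ`. The set of such times is nonempty because `(0, ε]` has positive
  -- measure.
  obtain ⟨τ, ⟨hτ0, hτε⟩, hτc⟩ : ∃ τ, τ ∈ Ioc 0 ε ∧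
      IsCompactOperator (S₂.adj.opAt τ - S₁.adj.opAt τ) := by
    obtain ⟨M, hM⟩ := C0Semigroup.exists_opAt_sub_le hA₁ hA₂ hb'
    have hne : (ae (volume.restrict (Ioc 0 ε))).NeBot := by
      rw [ae_neBot, Ne, Measure.restrict_eq_zero, Real.volume_Ioc, sub_zero]
      simpa using hε
    obtain ⟨τ, hτ, hτM, hτG⟩ :=
      ((ae_restrict_mem measurableSet_Ioc).and (hM.and hGcompact)).exists
    refine ⟨τ, hτ, CompactlyDominated.isCompactOperator hA₁.denseRange_incl
      ((((compactlyDominated_of_isCompactOperator _ hτG).add hGdom).const_mul M).mono hτM)⟩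
  have hτdom : CompactlyDominated (AdjointDomain.incl A₁)
      (C0Semigroup.diffEnergy hA₁ hA₂ B τ) := by
    obtain ⟨M, hM⟩ := C0Semigroup.exists_diffEnergy_le (hA₁ := hA₁) (hobs₂ ε) hG.1 hb
    exact (hGdom.const_mul M).mono fun z =>
      (C0Semigroup.diffEnergy_mono hA₁ hA₂ hτε z).trans (hM z)
  refine ⟨?_, fun T hT => ⟨(hobs₁ T).exists_inputMap hT.le, (hobs₂ T).exists_inputMap hT.le,
    fun Φ₁ Φ₂ h₁ h₂ => ?_⟩⟩
  · obtain ⟨Φ, hΦ⟩ := (hobs₂ 1).exists_inputMap zero_le_one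
    exact ⟨1, one_pos, fun u => ⟨Φ u, hΦ u⟩⟩
  -- The energy increases with time, so reaching some multiple `n τ ≥ T` is enough.
  · obtain ⟨n, hn⟩ := exists_nat_ge (T / τ)
    rw [div_le_iff₀ hτ0] at hn
    refine CompactlyDominated.isCompactOperator hA₁.denseRange_incl
      ((C0Semigroup.compactlyDominated_diffEnergy_nat_mul hobs₂ hτ0.le hτc hτdom n).mono
        fun z => ?_)
    rw [C0Semigroup.enorm_adjoint_sub_sq hT.le h₁ h₂]
    exact C0Semigroup.diffEnergy_mono hA₁ hA₂ hn z
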